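/- Let $0<a<\infty$. Let $L x=-\frac{d}{dt}\bigl((1-\frac{t^2}{a^2})\frac{dx}{dt}\bigr)+t^2x$ on $(-a,a)$. Let $\mathcal A$ be the set of functions $x:(-a,a)\to\mathbb C$ that are differentiable at every point and whose derivative is absolutely continuous on every compact subinterval of $(-a,a)$. Let $\mathcal L_{\max}$ be the operator in $L^2((-a,a))$ with domain $\{x\in L^2((-a,a))\cap\mathcal A: Lx\in L^2((-a,a))\}$ and action $\mathcal L_{\max}x=Lx$. Let $\mathcal L_{\min}$ be the closure of the restriction of $\mathcal L_{\max}$ to those $x$ in its domain whose support is a compact subset of $(-a,a)$. For $x$ in the domain of $\mathcal L_{\max}$ put $$b_{-a}(x)=\lim_{t\to-a+0}(t+a)x'(t),\qquad c_{-a}(x)=\lim_{t\to-a+0}\bigl((t+a)\ln(a+t)\,x'(t)-x(t)\bigr),$$ $$b_{a}(x)=\lim_{t\to a-0}(t-a)x'(t),\qquad c_{a}(x)=\lim_{t\to a-0}\bigl((t-a)\ln(a-t)\,x'(t)-x(t)\bigr).$$ For a complex $2\times2$ matrix $U=(u_{pq})$ let $\mathcal L_U$ be the restriction of $\mathcal L_{\max}$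 to those $x$ in its domain for which these four limits exist and satisfy $$(1+u_{11})\,b_{-a}(x)-i(1-u_{11})\,c_{-a}(x)+u_{12}\,b_a(x)+i u_{12}\,c_a(x)=0,$$ $$u_{21}\,b_{-a}(x)+i u_{21}\,c_{-a}(x)+(1+u_{22})\,b_a(x)-i(1-u_{22})\,c_a(x)=0.$$ **Theorem.** 1. If $U$ is unitary, then $\mathcal L_U$ is a self-adjoint operator in $L^2((-a,a))$, and $\mathcal L_{\min}\subset\mathcal L_U\subset\mathcal L_{\max}$ (both inclusions are proper). 2. Every self-adjoint operator $\mathcal L$ in $L^2((-a,a))$ that extends $\mathcal L_{\min}$ is of the form $\mathcal L=\mathcal L_U$ for some unitary $2\times 2$ matrix $U$. 3. For unitary $2\times2$ matrices $U_1,U_2$: $U_1=U_2$ if and only if $\mathcal L_{U_1}=\mathcal L_{U_2}$. -/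

import Mathlib

noncomputable section

open MeasureTheory Set Filter Topology

namespace Prolate

/-- Lebesgue measure on the open interval `(-a, a)`. -/
abbrev mu (a : ℝ) : Measure ℝ := volume.restrict (Ioo (-a) a)

/-- The Hilbert space `L²((-a, a))` of complex-valued functions. -/
abbrev H (a : ℝ) : Type := Lp ℂ 2 (mu a)

/-- The formal prolate spheroid operator
`(L x)(t) = -(d/dt) ((1 - t²/a²) dx/dt) + t² x(t)`. -/
def formalL (a : ℝ) (x : ℝ → ℂ) (t : ℝ) : ℂ :=
  -deriv (fun s : ℝ => ((1 - s ^ 2 / a ^ 2 : ℝ) : ℂ) * deriv x s) t + ((t ^ 2 : ℝ) : ℂ) * x t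

/-- The class `𝒜`: `x` is differentiable at every point of `(-a, a)`, and its derivative is
absolutely continuous on every compact subinterval of `(-a, a)`. A function on `(-a, a)` is
represented by a function on `ℝ`; its values outside `(-a, a)` play no role. -/
structure ClassA (a : ℝ) (x : ℝ → ℂ) : Prop where
  diff : ∀ t ∈ Ioo (-a) a, DifferentiableAt ℝ x t
  ac : ∀ α β : ℝ, -a < α → α ≤ β → β < a → AbsolutelyContinuousOnInterval (deriv x) α β

/-- The subclass of `𝒜` of functions whose support is a compact subset of `(-a, a)`. -/
structure ClassA₀ (a : ℝ) (x : ℝ → ℂ) : Prop extends ClassA a x where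
  supp : ∃ K : Set ℝ, IsCompact K ∧ K ⊆ Ioo (-a) a ∧ ∀ t ∈ Ioo (-a) a, t ∉ K → x t = 0

theorem ac_congr {f g : ℝ → ℂ} {α β : ℝ} (hf : AbsolutelyContinuousOnInterval f α β)
    (h : EqOn f g (uIcc α β)) : AbsolutelyContinuousOnInterval g α β := by
  rw [absolutelyContinuousOnInterval_iff] at hf ⊢
  intro ε hε
  obtain ⟨δ, hδ, H⟩ := hf ε hε
  refine ⟨δ, hδ, fun E hE hs => ?_⟩
  refine lt_of_eq_of_lt (Finset.sum_congr rfl fun i hi => ?_) (H E hE hs)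
  rw [h (hE.1 i hi).1, h (hE.1 i hi).2]

theorem ClassA.zero (a : ℝ) : ClassA a 0 :=
  ⟨fun _ _ => differentiableAt_const _, fun α β _ _ _ => by
    have h : deriv (0 : ℝ → ℂ) = fun _ => 0 := by ext t; simp
    rw [h, absolutelyContinuousOnInterval_iff]
    exact fun ε hε => ⟨1, one_pos, fun E _ _ => by simpa using hε⟩⟩

theorem ClassA.add {a : ℝ} {x y : ℝ → ℂ} (hx : ClassA a x) (hy : ClassA a y) :
    ClassA a (x + y) := by
  refine ⟨fun t ht => (hx.diff t ht).add (hy.diff t ht), fun α β h1 h2 h3 => ?_⟩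
  refine ac_congr ((hx.ac α β h1 h2 h3).add (hy.ac α β h1 h2 h3)) fun t ht => ?_
  rw [uIcc_of_le h2] at ht
  have ht' : t ∈ Ioo (-a) a := ⟨h1.trans_le ht.1, ht.2.trans_lt h3⟩
  rw [deriv_add (hx.diff t ht') (hy.diff t ht')]
  rfl

theorem ClassA.smul {a : ℝ} {x : ℝ → ℂ} (c : ℂ) (hx : ClassA a x) : ClassA a (c • x) := by
  refine ⟨fun t ht => (hx.diff t ht).const_smul c, fun α β h1 h2 h3 => ?_⟩
  refine ac_congr ((hx.ac α β h1 h2 h3).const_smul c) fun t ht => ?_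
  rw [uIcc_of_le h2] at ht
  have ht' : t ∈ Ioo (-a) a := ⟨h1.trans_le ht.1, ht.2.trans_lt h3⟩
  rw [deriv_const_smul c (hx.diff t ht')]

theorem ClassA.ae_differentiableAt {a : ℝ} {x : ℝ → ℂ} (hx : ClassA a x) :
    ∀ᵐ t ∂mu a, DifferentiableAt ℝ (deriv x) t := by
  rw [ae_restrict_iff' measurableSet_Ioo]
  have h : ∀ n : ℕ, ∀ᵐ t, t ∈ Icc (-a + 1 / ((n : ℝ) + 1)) (a - 1 / ((n : ℝ) + 1)) →
      DifferentiableAt ℝ (deriv x) t := by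
    intro n
    have hn : (0 : ℝ) < 1 / ((n : ℝ) + 1) := by positivity
    rcases le_or_gt (-a + 1 / ((n : ℝ) + 1)) (a - 1 / ((n : ℝ) + 1)) with hle | hlt
    · have := (hx.ac _ _ (by linarith) hle
        (by linarith)).boundedVariationOn.ae_differentiableAt_of_mem_uIcc
      rwa [uIcc_of_le hle] at this
    · exact Eventually.of_forall fun t ht => absurd (ht.1.trans ht.2) (not_le.2 hlt)
  filter_upwards [ae_all_iff.2 h] with t ht htI
  obtain ⟨n, hn⟩ := exists_nat_one_div_lt (lt_min (sub_pos.2 htI.1) (sub_pos.2 htI.2))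
  have h1 := hn.trans_le (min_le_left _ _)
  have h2 := hn.trans_le (min_le_right _ _)
  exact ht n ⟨by linarith, by linarith⟩

theorem formalL_congr {a : ℝ} {x y : ℝ → ℂ} (h : EqOn x y (Ioo (-a) a)) :
    EqOn (formalL a x) (formalL a y) (Ioo (-a) a) := by
  intro t ht
  have h1 : ∀ s ∈ Ioo (-a) a, deriv x s = deriv y s := fun s hs =>
    (h.eventuallyEq_of_mem (isOpen_Ioo.mem_nhds hs)).deriv_eq
  have h2 : (fun s : ℝ => ((1 - s ^ 2 / a ^ 2 : ℝ) : ℂ) * deriv x s) =ᶠ[𝓝 t]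
      fun s : ℝ => ((1 - s ^ 2 / a ^ 2 : ℝ) : ℂ) * deriv y s := by
    filter_upwards [isOpen_Ioo.mem_nhds ht] with s hs
    rw [h1 s hs]
  simp only [formalL, h2.deriv_eq, h ht]

theorem differentiableAt_flux (a : ℝ) {x : ℝ → ℂ} {t : ℝ}
    (h : DifferentiableAt ℝ (deriv x) t) :
    DifferentiableAt ℝ (fun s : ℝ => ((1 - s ^ 2 / a ^ 2 : ℝ) : ℂ) * deriv x s) t := by
  refine DifferentiableAt.mul ?_ h
  have : DifferentiableAt ℝ (fun s : ℝ => 1 - s ^ 2 / a ^ 2) t := by fun_prop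
  exact this.hasDerivAt.ofReal_comp.differentiableAt

theorem formalL_add {a : ℝ} {x y : ℝ → ℂ} (hx : ClassA a x) (hy : ClassA a y) :
    formalL a (x + y) =ᵐ[mu a] formalL a x + formalL a y := by
  filter_upwards [hx.ae_differentiableAt, hy.ae_differentiableAt,
    ae_restrict_mem measurableSet_Ioo] with t h1 h2 ht
  have h3 : (fun s : ℝ => ((1 - s ^ 2 / a ^ 2 : ℝ) : ℂ) * deriv (x + y) s) =ᶠ[𝓝 t]
      fun s : ℝ => ((1 - s ^ 2 / a ^ 2 : ℝ) : ℂ) * deriv x s +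
        ((1 - s ^ 2 / a ^ 2 : ℝ) : ℂ) * deriv y s := by
    filter_upwards [isOpen_Ioo.mem_nhds ht] with s hs
    rw [deriv_add (hx.diff s hs) (hy.diff s hs)]
    ring
  simp only [formalL, Pi.add_apply, h3.deriv_eq]
  rw [deriv_fun_add (differentiableAt_flux a h1) (differentiableAt_flux a h2)]
  ring

theorem formalL_smul {a : ℝ} {x : ℝ → ℂ} (c : ℂ) (hx : ClassA a x) :
    formalL a (c • x) =ᵐ[mu a] c • formalL a x := by
  filter_upwards [hx.ae_differentiableAt, ae_restrict_mem measurableSet_Ioo] with t h1 ht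
  have h3 : (fun s : ℝ => ((1 - s ^ 2 / a ^ 2 : ℝ) : ℂ) * deriv (c • x) s) =ᶠ[𝓝 t]
      fun s : ℝ => c • (((1 - s ^ 2 / a ^ 2 : ℝ) : ℂ) * deriv x s) := by
    filter_upwards [isOpen_Ioo.mem_nhds ht] with s hs
    rw [deriv_const_smul c (hx.diff s hs)]
    simp only [smul_eq_mul]
    ring
  simp only [formalL, Pi.smul_apply, h3.deriv_eq]
  rw [deriv_fun_const_smul c (differentiableAt_flux a h1)]
  simp only [smul_eq_mul]
  ring

/-- The graph of the maximal operator: the pairs `(x, L x)` in `L² × L²` with `x ∈ 𝒜`. -/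
def maxGraph (a : ℝ) : Submodule ℂ (H a × H a) where
  carrier := {p | ∃ x : ℝ → ℂ, ClassA a x ∧ p.1 =ᵐ[mu a] x ∧ p.2 =ᵐ[mu a] formalL a x}
  zero_mem' := by
    refine ⟨0, ClassA.zero a, Lp.coeFn_zero _ _ _, ?_⟩
    have h : formalL a 0 = 0 := by ext t; simp [formalL]
    rw [h]
    exact Lp.coeFn_zero _ _ _
  add_mem' := by
    rintro ⟨u, v⟩ ⟨u', v'⟩ ⟨x, hx, h1, h2⟩ ⟨y, hy, h3, h4⟩
    exact ⟨x + y, hx.add hy, (Lp.coeFn_add _ _).trans (h1.add h3),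
      (Lp.coeFn_add _ _).trans ((h2.add h4).trans (formalL_add hx hy).symm)⟩
  smul_mem' := by
    rintro c ⟨u, v⟩ ⟨x, hx, h1, h2⟩
    exact ⟨c • x, hx.smul c, (Lp.coeFn_smul _ _).trans (h1.const_smul c),
      (Lp.coeFn_smul _ _).trans ((h2.const_smul c).trans (formalL_smul c hx).symm)⟩

/-- The maximal operator: its domain consists of the `x ∈ L² ∩ 𝒜` with `L x ∈ L²`, and it acts
by `x ↦ L x`. -/
def Lmax (a : ℝ) : H a →ₗ.[ℂ] H a := (maxGraph a).toLinearPMap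

theorem ClassA.eqOn_of_ae {a : ℝ} {x y : ℝ → ℂ} (hx : ClassA a x) (hy : ClassA a y)
    (h : x =ᵐ[mu a] y) : EqOn x y (Ioo (-a) a) :=
  Measure.eqOn_open_of_ae_eq h isOpen_Ioo
    (fun t ht => (hx.diff t ht).continuousAt.continuousWithinAt)
    (fun t ht => (hy.diff t ht).continuousAt.continuousWithinAt)

/-- `maxGraph` is the graph of a single-valued operator, so that it is the graph of `Lmax`. -/
theorem graph_Lmax (a : ℝ) : (Lmax a).graph = maxGraph a := by
  refine Submodule.toLinearPMap_graph_eq _ ?_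
  rintro ⟨u, v⟩ ⟨x, hx, h1, h2⟩ (h0 : u = 0)
  subst h0
  have h3 : EqOn x 0 (Ioo (-a) a) :=
    hx.eqOn_of_ae (ClassA.zero a) (h1.symm.trans (Lp.coeFn_zero _ _ _))
  refine Lp.ext (h2.trans ?_)
  refine EventuallyEq.trans ?_ (Lp.coeFn_zero _ _ _).symm
  filter_upwards [ae_restrict_mem measurableSet_Ioo] with t ht
  rw [formalL_congr h3 ht]
  simp [formalL]

/-- The classes in `L²` of the functions of `ClassA₀`. -/
def coreDomain (a : ℝ) : Submodule ℂ (H a) where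
  carrier := {u | ∃ x : ℝ → ℂ, ClassA₀ a x ∧ u =ᵐ[mu a] x}
  zero_mem' := ⟨0, ⟨ClassA.zero a, ∅, isCompact_empty, empty_subset _, fun _ _ _ => rfl⟩,
    Lp.coeFn_zero _ _ _⟩
  add_mem' := by
    rintro u v ⟨x, ⟨hx, K, hK, hKI, hxK⟩, h1⟩ ⟨y, ⟨hy, K', hK', hKI', hyK⟩, h2⟩
    refine ⟨x + y, ⟨hx.add hy, K ∪ K', hK.union hK', union_subset hKI hKI', fun t ht htK => ?_⟩,
      (Lp.coeFn_add _ _).trans (h1.add h2)⟩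
    rw [mem_union, not_or] at htK
    rw [Pi.add_apply, hxK t ht htK.1, hyK t ht htK.2, add_zero]
  smul_mem' := by
    rintro c u ⟨x, ⟨hx, K, hK, hKI, hxK⟩, h1⟩
    refine ⟨c • x, ⟨hx.smul c, K, hK, hKI, fun t ht htK => ?_⟩,
      (Lp.coeFn_smul _ _).trans (h1.const_smul c)⟩
    rw [Pi.smul_apply, hxK t ht htK, smul_zero]

/-- The restriction of `Lmax` to the functions with compact support in `(-a, a)`. -/
def Lcore (a : ℝ) : H a →ₗ.[ℂ] H a := (Lmax a).domRestrict (coreDomain a)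

/-- The minimal operator: the closure of `Lcore`. -/
def Lmin (a : ℝ) : H a →ₗ.[ℂ] H a := (Lcore a).closure

/-- `bm, cm, bp, cp` are the generalized boundary values `b₋ₐ(x), c₋ₐ(x), bₐ(x), cₐ(x)`.
The limits are one-sided: `t` tends to the endpoint inside `(-a, a)`. -/
structure HasBoundaryValues (a : ℝ) (x : ℝ → ℂ) (bm cm bp cp : ℂ) : Prop where
  bm_lim : Tendsto (fun t : ℝ => ((t + a : ℝ) : ℂ) * deriv x t) (𝓝[Ioo (-a) a] (-a)) (𝓝 bm)
  cm_lim : Tendsto (fun t : ℝ => (((t + a) * Real.log (a + t) : ℝ) : ℂ) * deriv x t - x t)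
    (𝓝[Ioo (-a) a] (-a)) (𝓝 cm)
  bp_lim : Tendsto (fun t : ℝ => ((t - a : ℝ) : ℂ) * deriv x t) (𝓝[Ioo (-a) a] a) (𝓝 bp)
  cp_lim : Tendsto (fun t : ℝ => (((t - a) * Real.log (a - t) : ℝ) : ℂ) * deriv x t - x t)
    (𝓝[Ioo (-a) a] a) (𝓝 cp)

/-- The two boundary conditions determined by the matrix `U`. -/
def BoundaryCondition (U : Matrix (Fin 2) (Fin 2) ℂ) (bm cm bp cp : ℂ) : Prop :=
  (1 + U 0 0) * bm - Complex.I * (1 - U 0 0) * cm + U 0 1 * bp + Complex.I * U 0 1 * cp = 0 ∧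
  U 1 0 * bm + Complex.I * U 1 0 * cm + (1 + U 1 1) * bp - Complex.I * (1 - U 1 1) * cp = 0

theorem HasBoundaryValues.zero (a : ℝ) : HasBoundaryValues a 0 0 0 0 0 := by
  constructor <;> simp [tendsto_const_nhds]

theorem HasBoundaryValues.add {a : ℝ} {x y : ℝ → ℂ} (hx : ClassA a x) (hy : ClassA a y)
    {bm cm bp cp bm' cm' bp' cp' : ℂ} (h : HasBoundaryValues a x bm cm bp cp)
    (h' : HasBoundaryValues a y bm' cm' bp' cp') :
    HasBoundaryValues a (x + y) (bm + bm') (cm + cm') (bp + bp') (cp + cp') := by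
  have hd : ∀ t ∈ Ioo (-a) a, deriv (x + y) t = deriv x t + deriv y t := fun t ht =>
    deriv_add (hx.diff t ht) (hy.diff t ht)
  constructor
  · refine (h.bm_lim.add h'.bm_lim).congr' ?_
    filter_upwards [self_mem_nhdsWithin] with t ht
    rw [hd t ht]; ring
  · refine (h.cm_lim.add h'.cm_lim).congr' ?_
    filter_upwards [self_mem_nhdsWithin] with t ht
    rw [hd t ht, Pi.add_apply]; ring
  · refine (h.bp_lim.add h'.bp_lim).congr' ?_
    filter_upwards [self_mem_nhdsWithin] with t ht
    rw [hd t ht]; ring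
  · refine (h.cp_lim.add h'.cp_lim).congr' ?_
    filter_upwards [self_mem_nhdsWithin] with t ht
    rw [hd t ht, Pi.add_apply]; ring

theorem HasBoundaryValues.smul {a : ℝ} {x : ℝ → ℂ} (c : ℂ) (hx : ClassA a x)
    {bm cm bp cp : ℂ} (h : HasBoundaryValues a x bm cm bp cp) :
    HasBoundaryValues a (c • x) (c * bm) (c * cm) (c * bp) (c * cp) := by
  have hd : ∀ t ∈ Ioo (-a) a, deriv (c • x) t = c * deriv x t := fun t ht =>
    deriv_const_smul c (hx.diff t ht)
  constructor
  · refine (h.bm_lim.const_mul c).congr' ?_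
    filter_upwards [self_mem_nhdsWithin] with t ht
    rw [hd t ht]; ring
  · refine (h.cm_lim.const_mul c).congr' ?_
    filter_upwards [self_mem_nhdsWithin] with t ht
    rw [hd t ht, Pi.smul_apply, smul_eq_mul]; ring
  · refine (h.bp_lim.const_mul c).congr' ?_
    filter_upwards [self_mem_nhdsWithin] with t ht
    rw [hd t ht]; ring
  · refine (h.cp_lim.const_mul c).congr' ?_
    filter_upwards [self_mem_nhdsWithin] with t ht
    rw [hd t ht, Pi.smul_apply, smul_eq_mul]; ring

/-- The functions of class `𝒜` whose generalized boundary values exist and satisfy the boundary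
conditions determined by `U`. -/
def boundaryDomain (a : ℝ) (U : Matrix (Fin 2) (Fin 2) ℂ) : Submodule ℂ (H a) where
  carrier := {u | ∃ x : ℝ → ℂ, ClassA a x ∧ u =ᵐ[mu a] x ∧ ∃ bm cm bp cp : ℂ,
    HasBoundaryValues a x bm cm bp cp ∧ BoundaryCondition U bm cm bp cp}
  zero_mem' := ⟨0, ClassA.zero a, Lp.coeFn_zero _ _ _, 0, 0, 0, 0, HasBoundaryValues.zero a,
    by simp [BoundaryCondition]⟩
  add_mem' := by
    rintro u v ⟨x, hx, h1, bm, cm, bp, cp, hb, hU⟩ ⟨y, hy, h2, bm', cm', bp', cp', hb', hU'⟩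
    refine ⟨x + y, hx.add hy, (Lp.coeFn_add _ _).trans (h1.add h2), _, _, _, _,
      hb.add hx hy hb', ?_, ?_⟩
    · linear_combination hU.1 + hU'.1
    · linear_combination hU.2 + hU'.2
  smul_mem' := by
    rintro c u ⟨x, hx, h1, bm, cm, bp, cp, hb, hU⟩
    refine ⟨c • x, hx.smul c, (Lp.coeFn_smul _ _).trans (h1.const_smul c), _, _, _, _,
      hb.smul c hx, ?_, ?_⟩
    · linear_combination c * hU.1
    · linear_combination c * hU.2

/-- The operator `L_U`: the restriction of `Lmax` by the boundary conditions determined by `U`. -/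
def LU (a : ℝ) (U : Matrix (Fin 2) (Fin 2) ℂ) : H a →ₗ.[ℂ] H a :=
  (Lmax a).domRestrict (boundaryDomain a U)

end Prolate

end

noncomputable section

open MeasureTheory Set Filter Topology

namespace Prolate

/-! Write p = 1 - t²/a². For x, y in the maximal domain, Green's formula expresses ∫ (Lx·y - x·Ly)
as the difference of the endpoint limits of the Wronskian p(xy' - x'y); these limits exist because
the integrand is integrable. Choosing y = 1, log(a+t), log(a-t), all square integrable, turns them
into the numbers b and c. So the four boundary values exist on the whole maximal domain
(`InDomain.exists_boundaryValues`), and Green's formula becomes a form in them alone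
(`InDomain.integral_green`). Combinations of 1, t and the two logarithms realize every vector of ℂ⁴
(`exists_inDomain_hasBoundaryValues`).

In the coordinates w = b + ic, v = b - ic, each a vector in ℂ² with one entry per endpoint, the
boundary form is a multiple of ⟨v', v⟩ - ⟨w', w⟩ (`inner_sub_inner`), and the conditions defining
L_U read v = -Uw (`boundaryCondition_iff`). A subspace of ℂ² × ℂ² that equals its own orthogonal
complement for this form is the graph of a unitary matrix (`exists_unitary_of_lagrangian`).

The analytic ingredient is that the adjoint of the compactly supported restriction lies in the
maximal operator (`adjoint_graph_Lcore_le`), by a du Bois-Reymond argument. Hence every self-adjoint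
extension of the minimal operator lies in the maximal one, and its self-adjointness becomes a
statement about its space of traces (w, v). The minimal operator never has to be identified with the
functions of zero trace: it is enough that compactly supported functions have zero trace. -/

/-! ### Absolute continuity of complex-valued functions. -/

theorem ac_ofReal {f : ℝ → ℝ} {α β : ℝ} (hf : AbsolutelyContinuousOnInterval f α β) :
    AbsolutelyContinuousOnInterval (fun t => (f t : ℂ)) α β := by
  simpa only [AbsolutelyContinuousOnInterval, Complex.isometry_ofReal.dist_eq] using hf

theorem ac_const (c : ℂ) (α β : ℝ) : AbsolutelyContinuousOnInterval (fun _ : ℝ => c) α β :=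
  contDiffOn_const.absolutelyContinuousOnInterval

theorem ac_conj {f : ℝ → ℂ} {α β : ℝ} (hf : AbsolutelyContinuousOnInterval f α β) :
    AbsolutelyContinuousOnInterval (fun t => star (f t)) α β := by
  simpa only [AbsolutelyContinuousOnInterval, dist_star_star] using hf

theorem ac_intervalIntegral {f : ℝ → ℂ} {α β c : ℝ} (h : IntervalIntegrable f volume α β)
    (hc : c ∈ uIcc α β) : AbsolutelyContinuousOnInterval (fun t => ∫ s in c..t, f s) α β := by
  have hre : IntervalIntegrable (fun s => (f s).re) volume α β :=
    ⟨h.1.re, h.2.re⟩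
  have him : IntervalIntegrable (fun s => (f s).im) volume α β :=
    ⟨h.1.im, h.2.im⟩
  have h1 := ac_ofReal (hre.absolutelyContinuousOnInterval_intervalIntegral hc)
  have h2 := ac_ofReal (him.absolutelyContinuousOnInterval_intervalIntegral hc)
  refine ac_congr (h1.add (h2.const_smul Complex.I)) fun t ht => ?_
  have hs : uIcc c t ⊆ uIcc α β := uIcc_subset_uIcc hc ht
  have hre' : IntervalIntegrable (fun s => ((f s).re : ℂ)) volume c t :=
    ⟨(hre.mono_set hs).1.ofReal, (hre.mono_set hs).2.ofReal⟩
  have him' : IntervalIntegrable (fun s => ((f s).im : ℂ)) volume c t :=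
    ⟨(him.mono_set hs).1.ofReal, (him.mono_set hs).2.ofReal⟩
  simp only [Pi.add_apply, smul_eq_mul]
  rw [← intervalIntegral.integral_ofReal, ← intervalIntegral.integral_ofReal,
    ← intervalIntegral.integral_const_mul, ← intervalIntegral.integral_add hre'
      (him'.const_mul _)]
  refine intervalIntegral.integral_congr fun s _ => ?_
  rw [mul_comm]
  exact Complex.re_add_im (f s)

/-- The fundamental theorem of calculus for complex-valued absolutely continuous functions. -/
theorem integral_eq_sub_of_ac {f g : ℝ → ℂ} {α β : ℝ}
    (hg : AbsolutelyContinuousOnInterval g α β) (hf : IntervalIntegrable f volume α β)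
    (h : ∀ᵐ t, t ∈ uIcc α β → HasDerivAt g (f t) t) : ∫ t in α..β, f t = g β - g α := by
  have hac : AbsolutelyContinuousOnInterval (fun t => g t - ∫ s in α..t, f s) α β :=
    hg.sub (ac_intervalIntegral hf left_mem_uIcc)
  obtain ⟨C, hC⟩ := hac.const_of_ae_hasDerivAt_zero (by
    filter_upwards [h, hf.ae_hasDerivAt_integral] with t h1 h2 ht
    simpa using (h1 ht).fun_sub (h2 ht α left_mem_uIcc))
  have h1 := hC α left_mem_uIcc
  have h2 := hC β right_mem_uIcc
  simp only [intervalIntegral.integral_same, sub_zero] at h1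
  rw [h1, ← h2]
  ring

/-! ### The quasi-derivative and Green's formula. -/

/-- The leading coefficient `1 - t² / a²` of the operator. -/
abbrev weight (a t : ℝ) : ℝ := 1 - t ^ 2 / a ^ 2

/-- The quasi-derivative `(1 - t² / a²) x'`. -/
def flux (a : ℝ) (x : ℝ → ℂ) (t : ℝ) : ℂ := (weight a t : ℂ) * deriv x t

theorem weight_eq {a : ℝ} (ha : 0 < a) (t : ℝ) : weight a t = (a - t) * (a + t) / a ^ 2 := by
  rw [weight]
  field_simp
  ring

theorem weight_pos {a t : ℝ} (ht : t ∈ Ioo (-a) a) : 0 < weight a t := by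
  have ha : 0 < a := by linarith [ht.1, ht.2]
  rw [weight_eq ha]
  have h1 : 0 < a - t := by linarith [ht.2]
  have h2 : 0 < a + t := by linarith [ht.1]
  positivity

theorem weight_ne_zero {a t : ℝ} (ht : t ∈ Ioo (-a) a) : (weight a t : ℂ) ≠ 0 :=
  Complex.ofReal_ne_zero.2 (weight_pos ht).ne'

theorem contDiff_weight (a : ℝ) : ContDiff ℝ 1 (weight a) := by
  unfold weight
  fun_prop

theorem Icc_subset_interval {a α β : ℝ} (h1 : -a < α) (h3 : β < a) :
    Icc α β ⊆ Ioo (-a) a := fun _ ht => ⟨h1.trans_le ht.1, ht.2.trans_lt h3⟩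

theorem ClassA.continuousOn {a : ℝ} {x : ℝ → ℂ} (hx : ClassA a x) : ContinuousOn x (Ioo (-a) a) :=
  fun t ht => (hx.diff t ht).continuousAt.continuousWithinAt

theorem ClassA.continuousOn_deriv {a : ℝ} {x : ℝ → ℂ} (hx : ClassA a x) :
    ContinuousOn (deriv x) (Ioo (-a) a) := by
  intro t ht
  obtain ⟨α, h1, h2⟩ := exists_between ht.1
  obtain ⟨β, h3, h4⟩ := exists_between ht.2
  have h := (hx.ac α β h1 (h2.trans h3).le h4).continuousOn
  rw [uIcc_of_le (h2.trans h3).le] at h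
  exact (h.continuousAt (Icc_mem_nhds h2 h3)).continuousWithinAt

/-- On a compact subinterval x is the integral of its continuous derivative. Green's formula needs
this because it differentiates products of x with a quasi-derivative. -/
theorem ClassA.ac_self {a : ℝ} {x : ℝ → ℂ} (hx : ClassA a x) {α β : ℝ} (h1 : -a < α) (h2 : α ≤ β)
    (h3 : β < a) : AbsolutelyContinuousOnInterval x α β := by
  have hs := Icc_subset_interval h1 h3
  have hi : IntervalIntegrable (deriv x) volume α β :=
    ContinuousOn.intervalIntegrable (by
      rw [uIcc_of_le h2]; exact hx.continuousOn_deriv.mono hs)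
  have hc : AbsolutelyContinuousOnInterval (fun _ : ℝ => x α) α β :=
    ac_const _ α β
  refine ac_congr (hc.add (ac_intervalIntegral hi left_mem_uIcc)) fun t ht => ?_
  have ht' := ht
  rw [uIcc_of_le h2] at ht'
  simp only [Pi.add_apply]
  rw [intervalIntegral.integral_deriv_eq_sub (fun s hs' => ?_)
    (hi.mono_set (uIcc_subset_uIcc left_mem_uIcc ht))]
  · ring
  · rw [uIcc_of_le ht'.1] at hs'
    exact hx.diff s (hs ⟨hs'.1, hs'.2.trans ht'.2⟩)

theorem ClassA.ac_flux {a : ℝ} {x : ℝ → ℂ} (hx : ClassA a x) {α β : ℝ} (h1 : -a < α) (h2 : α ≤ β)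
    (h3 : β < a) : AbsolutelyContinuousOnInterval (flux a x) α β :=
  (ac_ofReal (contDiff_weight a).contDiffOn.absolutelyContinuousOnInterval).fun_smul
    (hx.ac α β h1 h2 h3)

theorem ClassA.hasDerivAt_flux {a : ℝ} {x : ℝ → ℂ} (hx : ClassA a x) :
    ∀ᵐ t ∂mu a, HasDerivAt (flux a x) (((t ^ 2 : ℝ) : ℂ) * x t - formalL a x t) t := by
  filter_upwards [hx.ae_differentiableAt] with t ht
  have h : HasDerivAt (flux a x) (deriv (flux a x) t) t := (differentiableAt_flux a ht).hasDerivAt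
  have h' : formalL a x t = -deriv (flux a x) t + ((t ^ 2 : ℝ) : ℂ) * x t := rfl
  rw [h']
  simpa using h

/-- The modified Wronskian `(1 - t² / a²) (x y' - x' y)`. -/
def wronskian (a : ℝ) (x y : ℝ → ℂ) (t : ℝ) : ℂ := x t * flux a y t - flux a x t * y t

/-- Green's formula on a compact subinterval. -/
theorem green {a : ℝ} {x y : ℝ → ℂ} (hx : ClassA a x) (hy : ClassA a y) {α β : ℝ} (h1 : -a < α)
    (h2 : α ≤ β) (h3 : β < a)
    (hi : IntervalIntegrable (fun t => formalL a x t * y t - x t * formalL a y t) volume α β) :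
    ∫ t in α..β, (formalL a x t * y t - x t * formalL a y t) =
      wronskian a x y β - wronskian a x y α := by
  refine integral_eq_sub_of_ac (((hx.ac_self h1 h2 h3).fun_smul (hy.ac_flux h1 h2 h3)).sub
    ((hx.ac_flux h1 h2 h3).fun_smul (hy.ac_self h1 h2 h3))) hi ?_
  have h4 := hx.hasDerivAt_flux
  have h5 := hy.hasDerivAt_flux
  rw [ae_restrict_iff' measurableSet_Ioo] at h4 h5
  filter_upwards [h4, h5] with t h4 h5 ht
  rw [uIcc_of_le h2] at ht
  have htI := Icc_subset_interval h1 h3 ht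
  have h6 := ((hx.diff t htI).hasDerivAt.mul (h5 htI)).sub
    ((h4 htI).mul (hy.diff t htI).hasDerivAt)
  refine h6.congr_deriv ?_
  simp only [flux]
  ring

/-- A function whose derivative is `q / (1 - t² / a²)` with `q` locally absolutely continuous
belongs to the class `𝒜`. -/
theorem classA_of_hasDerivAt {a : ℝ} {x q : ℝ → ℂ}
    (hx : ∀ t ∈ Ioo (-a) a, HasDerivAt x (q t / (weight a t : ℂ)) t)
    (hq : ∀ α β : ℝ, -a < α → α ≤ β → β < a → AbsolutelyContinuousOnInterval q α β) :
    ClassA a x := by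
  refine ⟨fun t ht => (hx t ht).differentiableAt, fun α β h1 h2 h3 => ?_⟩
  have hs := Icc_subset_interval h1 h3
  have hw : AbsolutelyContinuousOnInterval (fun t => (weight a t)⁻¹) α β := by
    refine ContDiffOn.absolutelyContinuousOnInterval ?_
    rw [uIcc_of_le h2]
    exact (contDiff_weight a).contDiffOn.inv fun t ht => (weight_pos (hs ht)).ne'
  refine ac_congr ((hq α β h1 h2 h3).fun_smul (ac_ofReal hw)) fun t ht => ?_
  rw [uIcc_of_le h2] at ht
  rw [(hx t (hs ht)).deriv]
  simp [div_eq_mul_inv]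

theorem flux_eq {a : ℝ} {x q : ℝ → ℂ}
    (hx : ∀ t ∈ Ioo (-a) a, HasDerivAt x (q t / (weight a t : ℂ)) t) :
    EqOn (flux a x) q (Ioo (-a) a) := fun t ht => by
  rw [flux, (hx t ht).deriv, mul_div_cancel₀ _ (weight_ne_zero ht)]

theorem formalL_eq {a : ℝ} {x q : ℝ → ℂ}
    (hx : ∀ t ∈ Ioo (-a) a, HasDerivAt x (q t / (weight a t : ℂ)) t) {t : ℝ} {d : ℂ}
    (ht : t ∈ Ioo (-a) a) (hd : HasDerivAt q d t) :
    formalL a x t = -d + ((t ^ 2 : ℝ) : ℂ) * x t := by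
  have h : HasDerivAt (flux a x) d t :=
    hd.congr_of_eventuallyEq ((flux_eq hx).eventuallyEq_of_mem (isOpen_Ioo.mem_nhds ht))
  have h' := h.deriv
  unfold flux weight at h'
  rw [formalL, h']

/-! ### Solving (px')' = f. -/

/-- The function with prescribed quasi-derivative `c + ∫₀ᵗ f` and prescribed value `d` at `0`. -/
def primitive (a : ℝ) (f : ℝ → ℂ) (c d : ℂ) (t : ℝ) : ℂ :=
  d + ∫ s in (0 : ℝ)..t, (c + ∫ r in (0 : ℝ)..s, f r) / (weight a s : ℂ)

theorem uIcc_subset_interval {a α β : ℝ} (h1 : α ∈ Ioo (-a) a) (h2 : β ∈ Ioo (-a) a) :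
    uIcc α β ⊆ Ioo (-a) a := ordConnected_Ioo.uIcc_subset h1 h2

theorem intervalIntegrable_of_integrable {a : ℝ} {f : ℝ → ℂ} (hf : Integrable f (mu a)) {α β : ℝ}
    (h1 : α ∈ Ioo (-a) a) (h2 : β ∈ Ioo (-a) a) : IntervalIntegrable f volume α β :=
  intervalIntegrable_iff.2 (IntegrableOn.mono_set hf
    (uIoc_subset_uIcc.trans (uIcc_subset_interval h1 h2)))

theorem zero_mem_interval {a t : ℝ} (ht : t ∈ Ioo (-a) a) : (0 : ℝ) ∈ Ioo (-a) a :=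
  ⟨by linarith [ht.1, ht.2], by linarith [ht.1, ht.2]⟩

theorem ac_primitive_flux {a : ℝ} {f : ℝ → ℂ} (hf : Integrable f (mu a)) (c : ℂ) {α β : ℝ}
    (h1 : -a < α) (h2 : α ≤ β) (h3 : β < a) :
    AbsolutelyContinuousOnInterval (fun s => c + ∫ r in (0 : ℝ)..s, f r) α β := by
  have hα : α ∈ Ioo (-a) a := ⟨h1, h2.trans_lt h3⟩
  have hβ : β ∈ Ioo (-a) a := ⟨h1.trans_le h2, h3⟩
  have h0 := zero_mem_interval hα
  have hm : min α 0 ∈ Ioo (-a) a := ⟨lt_min h1 h0.1, (min_le_right _ _).trans_lt h0.2⟩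
  have hM : max β 0 ∈ Ioo (-a) a := ⟨h0.1.trans_le (le_max_right _ _), max_lt h3 h0.2⟩
  have hc : AbsolutelyContinuousOnInterval (fun _ : ℝ => c) α β :=
    ac_const _ α β
  have h : AbsolutelyContinuousOnInterval (fun s => ∫ r in (0 : ℝ)..s, f r) (min α 0) (max β 0) :=
    ac_intervalIntegral (intervalIntegrable_of_integrable hf hm hM)
      (by rw [uIcc_of_le ((min_le_right _ _).trans (le_max_right _ _))]
          exact ⟨min_le_right _ _, le_max_right _ _⟩)
  refine hc.add (h.mono ?_)
  rw [uIcc_of_le h2, uIcc_of_le ((min_le_right _ _).trans (le_max_right _ _))]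
  exact Icc_subset_Icc (min_le_left _ _) (le_max_left _ _)

theorem continuousOn_primitive_flux {a : ℝ} {f : ℝ → ℂ} (hf : Integrable f (mu a)) (c : ℂ) :
    ContinuousOn (fun s => c + ∫ r in (0 : ℝ)..s, f r) (Ioo (-a) a) := by
  intro t ht
  obtain ⟨α, h1, h2⟩ := exists_between ht.1
  obtain ⟨β, h3, h4⟩ := exists_between ht.2
  have h := (ac_primitive_flux hf c h1 (h2.trans h3).le h4).continuousOn
  rw [uIcc_of_le (h2.trans h3).le] at h
  exact (h.continuousAt (Icc_mem_nhds h2 h3)).continuousWithinAt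

theorem continuousOn_primitive_deriv {a : ℝ} {f : ℝ → ℂ} (hf : Integrable f (mu a)) (c : ℂ) :
    ContinuousOn (fun s => (c + ∫ r in (0 : ℝ)..s, f r) / (weight a s : ℂ)) (Ioo (-a) a) :=
  (continuousOn_primitive_flux hf c).div
    (Complex.continuous_ofReal.comp (contDiff_weight a).continuous).continuousOn
    fun _ ht => weight_ne_zero ht

/-- The inner integral is continuous, so the outer integrand is too, and the derivative exists at
every point rather than almost everywhere. The class 𝒜 demands exactly this. -/
theorem hasDerivAt_primitive {a : ℝ} {f : ℝ → ℂ} (hf : Integrable f (mu a)) (c d : ℂ) {t : ℝ}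
    (ht : t ∈ Ioo (-a) a) :
    HasDerivAt (primitive a f c d) ((c + ∫ r in (0 : ℝ)..t, f r) / (weight a t : ℂ)) t := by
  have hc := continuousOn_primitive_deriv hf c
  refine HasDerivAt.const_add d (intervalIntegral.integral_hasDerivAt_right ?_ ?_ ?_)
  · exact (hc.mono (uIcc_subset_interval (zero_mem_interval ht) ht)).intervalIntegrable
  · exact hc.stronglyMeasurableAtFilter isOpen_Ioo t ht
  · exact hc.continuousAt (isOpen_Ioo.mem_nhds ht)

theorem classA_primitive {a : ℝ} {f : ℝ → ℂ} (hf : Integrable f (mu a)) (c d : ℂ) :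
    ClassA a (primitive a f c d) :=
  classA_of_hasDerivAt (fun _ ht => hasDerivAt_primitive hf c d ht)
    fun _ _ h1 h2 h3 => ac_primitive_flux hf c h1 h2 h3

theorem formalL_primitive {a : ℝ} {f : ℝ → ℂ} (hf : Integrable f (mu a)) (c d : ℂ) :
    ∀ᵐ t ∂mu a, formalL a (primitive a f c d) t =
      -f t + ((t ^ 2 : ℝ) : ℂ) * primitive a f c d t := by
  have h : ∀ᵐ t ∂mu a, HasDerivAt (fun s => c + ∫ r in (0 : ℝ)..s, f r) (f t) t := by
    -- Outside the interval `f` is arbitrary. Its extension by zero is integrable on ℝ, so Lebesgue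
    -- differentiation applies, and inside the interval the integrals are unchanged.
    have hind : Integrable ((Ioo (-a) a).indicator f) :=
      (integrable_indicator_iff measurableSet_Ioo).2 hf
    rw [ae_restrict_iff' measurableSet_Ioo]
    filter_upwards [LocallyIntegrable.ae_hasDerivAt_integral hind.locallyIntegrable] with t ht htI
    have h1 := (ht 0).const_add c
    rw [indicator_of_mem htI] at h1
    refine h1.congr_of_eventuallyEq ?_
    filter_upwards [isOpen_Ioo.mem_nhds htI] with s hs
    congr 1
    refine intervalIntegral.integral_congr fun r hr => ?_
    exact (indicator_of_mem (uIcc_subset_interval (zero_mem_interval htI) hs hr) f).symm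
  filter_upwards [h, ae_restrict_mem measurableSet_Ioo] with t h1 ht
  exact formalL_eq (fun _ ht => hasDerivAt_primitive hf c d ht) ht h1

/-! ### The maximal domain and the model functions 1, t, log(a+t), log(a-t). -/

/-- `x` represents an element of the domain of the maximal operator. -/
structure InDomain (a : ℝ) (x : ℝ → ℂ) : Prop where
  classA : ClassA a x
  memLp : MemLp x 2 (mu a)
  memLp_formalL : MemLp (formalL a x) 2 (mu a)

theorem InDomain.add {a : ℝ} {x y : ℝ → ℂ} (hx : InDomain a x) (hy : InDomain a y) :
    InDomain a (x + y) :=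
  ⟨hx.classA.add hy.classA, hx.memLp.add hy.memLp,
    (memLp_congr_ae (formalL_add hx.classA hy.classA)).2 (hx.memLp_formalL.add hy.memLp_formalL)⟩

theorem InDomain.smul {a : ℝ} {x : ℝ → ℂ} (c : ℂ) (hx : InDomain a x) : InDomain a (c • x) :=
  ⟨hx.classA.smul c, hx.memLp.const_smul c,
    (memLp_congr_ae (formalL_smul c hx.classA)).2 (hx.memLp_formalL.const_smul c)⟩

/-- The coefficients of L are real. This lets the bilinear Green formula serve the sesquilinear
inner product. -/
theorem formalL_star (a : ℝ) (x : ℝ → ℂ) (t : ℝ) :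
    formalL a (fun s => star (x s)) t = star (formalL a x t) := by
  have h : (fun s : ℝ => ((1 - s ^ 2 / a ^ 2 : ℝ) : ℂ) * deriv (fun s => star (x s)) s) =
      fun s => star (((1 - s ^ 2 / a ^ 2 : ℝ) : ℂ) * deriv x s) := by
    ext s
    rw [deriv.star, star_mul', Complex.star_def, Complex.conj_ofReal]
  simp only [formalL]
  rw [h, deriv.star, star_add, star_neg, star_mul', Complex.star_def, Complex.conj_ofReal]

theorem ClassA.star {a : ℝ} {x : ℝ → ℂ} (hx : ClassA a x) : ClassA a fun t => star (x t) := by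
  refine ⟨fun t ht => (hx.diff t ht).star, fun α β h1 h2 h3 => ?_⟩
  have h : deriv (fun t => Star.star (x t)) = fun t => Star.star (deriv x t) := by
    ext t
    exact deriv.star
  rw [h]
  exact ac_conj (hx.ac α β h1 h2 h3)

theorem InDomain.star {a : ℝ} {x : ℝ → ℂ} (hx : InDomain a x) :
    InDomain a fun t => star (x t) :=
  ⟨hx.classA.star, hx.memLp.star, by
    rw [show formalL a (fun t => Star.star (x t)) = Star.star (formalL a x) from
      funext (formalL_star a x)]
    exact hx.memLp_formalL.star⟩

theorem HasBoundaryValues.star {a : ℝ} {x : ℝ → ℂ} {bm cm bp cp : ℂ}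
    (h : HasBoundaryValues a x bm cm bp cp) :
    HasBoundaryValues a (fun t => star (x t)) (star bm) (star cm) (star bp) (star cp) := by
  constructor
  · refine h.bm_lim.star.congr fun t => ?_
    rw [deriv.star, star_mul', Complex.star_def, Complex.conj_ofReal]
  · refine h.cm_lim.star.congr fun t => ?_
    rw [deriv.star, star_sub, star_mul', Complex.star_def, Complex.conj_ofReal]
  · refine h.bp_lim.star.congr fun t => ?_
    rw [deriv.star, star_mul', Complex.star_def, Complex.conj_ofReal]
  · refine h.cp_lim.star.congr fun t => ?_
    rw [deriv.star, star_sub, star_mul', Complex.star_def, Complex.conj_ofReal]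

theorem exists_bound_of_continuous (a : ℝ) {f : ℝ → ℂ} (hf : Continuous f) :
    ∃ C : ℝ, ∀ᵐ t ∂mu a, ‖f t‖ ≤ C := by
  obtain ⟨C, hC⟩ := (isCompact_Icc (a := -a) (b := a)).exists_bound_of_continuousOn hf.continuousOn
  refine ⟨C, ?_⟩
  filter_upwards [ae_restrict_mem measurableSet_Ioo] with t ht
  exact hC t (Ioo_subset_Icc_self ht)

theorem memLp_of_continuous (a : ℝ) {f : ℝ → ℂ} (hf : Continuous f) : MemLp f 2 (mu a) := by
  obtain ⟨C, hC⟩ := exists_bound_of_continuous a hf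
  exact MemLp.of_bound hf.aestronglyMeasurable C hC

theorem memLp_continuous_mul {a : ℝ} {f g : ℝ → ℂ} (hf : Continuous f) (hg : MemLp g 2 (mu a)) :
    MemLp (fun t => f t * g t) 2 (mu a) := by
  obtain ⟨C, hC⟩ := exists_bound_of_continuous a hf
  refine hg.of_le_mul (c := C) (hf.aestronglyMeasurable.mul hg.aestronglyMeasurable) ?_
  filter_upwards [hC] with t ht
  rw [norm_mul]
  gcongr

/-- A square integrable function whose quasi-derivative is continuously differentiable on the
closed interval belongs to the maximal domain. -/
theorem inDomain_of_hasDerivAt {a : ℝ} {x q : ℝ → ℂ}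
    (hx : ∀ t ∈ Ioo (-a) a, HasDerivAt x (q t / (weight a t : ℂ)) t) (hq : ContDiff ℝ 1 q)
    (hx2 : MemLp x 2 (mu a)) : InDomain a x := by
  refine ⟨classA_of_hasDerivAt hx fun α β _ _ _ => hq.contDiffOn.absolutelyContinuousOnInterval,
    hx2, ?_⟩
  have h1 : MemLp (fun t => -deriv q t + ((t ^ 2 : ℝ) : ℂ) * x t) 2 (mu a) :=
    (memLp_of_continuous a (hq.continuous_deriv le_rfl)).neg.add
      (memLp_continuous_mul (by fun_prop) hx2)
  refine (memLp_congr_ae ?_).2 h1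
  filter_upwards [ae_restrict_mem measurableSet_Ioo] with t ht
  exact formalL_eq hx ht (hq.differentiable one_ne_zero t).hasDerivAt

theorem hasDerivAt_one (a : ℝ) : ∀ t ∈ Ioo (-a) a,
    HasDerivAt (fun _ : ℝ => (1 : ℂ)) ((0 : ℂ) / (weight a t : ℂ)) t := fun t _ => by
  simpa using hasDerivAt_const t (1 : ℂ)

theorem inDomain_one (a : ℝ) : InDomain a fun _ => (1 : ℂ) :=
  inDomain_of_hasDerivAt (q := fun _ => 0) (hasDerivAt_one a) contDiff_const (memLp_const _)

theorem inDomain_id (a : ℝ) : InDomain a fun t => (t : ℂ) := by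
  refine inDomain_of_hasDerivAt (q := fun t => (weight a t : ℂ)) (fun t ht => ?_) ?_
    (memLp_of_continuous a Complex.continuous_ofReal)
  · rw [div_self (weight_ne_zero ht)]
    exact (hasDerivAt_id t).ofReal_comp
  · exact Complex.ofRealCLM.contDiff.comp (contDiff_weight a)

theorem hasDerivAt_log_add {a : ℝ} : ∀ t ∈ Ioo (-a) a,
    HasDerivAt (fun t : ℝ => (Real.log (a + t) : ℂ))
      ((((a - t) / a ^ 2 : ℝ) : ℂ) / (weight a t : ℂ)) t := by
  intro t ht
  have ha : 0 < a := by linarith [ht.1, ht.2]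
  have h1 : a - t ≠ 0 := by linarith [ht.2]
  have h2 : a + t ≠ 0 := by linarith [ht.1]
  have h := (((hasDerivAt_id t).const_add a).log h2).ofReal_comp
  refine h.congr_deriv ?_
  rw [← Complex.ofReal_div, weight_eq ha]
  congr 1
  simp only [id]
  field_simp

theorem hasDerivAt_log_sub {a : ℝ} : ∀ t ∈ Ioo (-a) a,
    HasDerivAt (fun t : ℝ => (Real.log (a - t) : ℂ))
      (((-(a + t) / a ^ 2 : ℝ) : ℂ) / (weight a t : ℂ)) t := by
  intro t ht
  have ha : 0 < a := by linarith [ht.1, ht.2]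
  have h1 : a - t ≠ 0 := by linarith [ht.2]
  have h2 : a + t ≠ 0 := by linarith [ht.1]
  have h := (((hasDerivAt_id t).const_sub a).log h1).ofReal_comp
  refine h.congr_deriv ?_
  rw [← Complex.ofReal_div, weight_eq ha]
  congr 1
  simp only [id]
  field_simp

/-- A continuous primitive of `log²`. -/
def logSqPrimitive (s : ℝ) : ℝ := 4 * (√s * Real.log √s) ^ 2 - 2 * (s * Real.log s) + 2 * s

/-- The usual term s log² s is written as 4(√s log √s)², so that continuity at 0 reduces to that of
r log r. -/
theorem continuous_logSqPrimitive : Continuous logSqPrimitive := by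
  have h1 : Continuous fun s : ℝ => √s * Real.log √s :=
    Real.continuous_mul_log.comp Real.continuous_sqrt
  have h2 := Real.continuous_mul_log
  unfold logSqPrimitive
  fun_prop

theorem hasDerivAt_logSqPrimitive {s : ℝ} (hs : 0 < s) :
    HasDerivAt logSqPrimitive (Real.log s ^ 2) s := by
  have h : HasDerivAt (fun s => s * Real.log s ^ 2 - 2 * (s * Real.log s) + 2 * s)
      (Real.log s ^ 2) s := by
    have hl := Real.hasDerivAt_log hs.ne'
    have hi := hasDerivAt_id s
    refine (((hi.mul (hl.pow 2)).sub ((hi.mul hl).const_mul 2)).add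
      (hi.const_mul 2)).congr_deriv ?_
    simp only [id, Pi.pow_apply]
    field_simp
    push_cast
    ring
  refine h.congr_of_eventuallyEq ?_
  filter_upwards [lt_mem_nhds hs] with r hr
  rw [logSqPrimitive, Real.log_sqrt hr.le, mul_pow, Real.sq_sqrt hr.le]
  ring

/-- log² is nonnegative and has a primitive continuous up to the singular endpoint, hence it is
integrable. -/
theorem memLp_log_add (a : ℝ) : MemLp (fun t : ℝ => (Real.log (a + t) : ℂ)) 2 (mu a) := by
  refine MemLp.ofReal ((memLp_two_iff_integrable_sq
    (Real.measurable_log.comp (measurable_const_add a)).aestronglyMeasurable).2 ?_)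
  refine (intervalIntegral.integrableOn_deriv_of_nonneg
    (g := fun t => logSqPrimitive (a + t)) (a := -a) (b := a) ?_ ?_ ?_).mono_set Ioo_subset_Ioc_self
  · exact (continuous_logSqPrimitive.comp (continuous_const.add continuous_id)).continuousOn
  · intro t ht
    exact (hasDerivAt_logSqPrimitive (by linarith [ht.1])).comp_const_add a t
  · exact fun t _ => sq_nonneg _

theorem memLp_log_sub (a : ℝ) : MemLp (fun t : ℝ => (Real.log (a - t) : ℂ)) 2 (mu a) := by
  refine MemLp.ofReal ((memLp_two_iff_integrable_sq
    (Real.measurable_log.comp (measurable_const_sub a)).aestronglyMeasurable).2 ?_)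
  refine (intervalIntegral.integrableOn_deriv_of_nonneg
    (g := fun t => -logSqPrimitive (a - t)) (a := -a) (b := a) ?_ ?_ ?_).mono_set
    Ioo_subset_Ioc_self
  · exact (continuous_logSqPrimitive.comp (continuous_const.sub continuous_id)).neg.continuousOn
  · intro t ht
    have h := hasDerivAt_logSqPrimitive (s := a - t) (by linarith [ht.2])
    simpa using (h.comp_const_sub a t).fun_neg
  · exact fun t _ => sq_nonneg _

theorem inDomain_log_add (a : ℝ) : InDomain a fun t => (Real.log (a + t) : ℂ) :=
  inDomain_of_hasDerivAt hasDerivAt_log_add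
    (Complex.ofRealCLM.contDiff.comp (by fun_prop : ContDiff ℝ 1 fun t : ℝ => (a - t) / a ^ 2))
    (memLp_log_add a)

theorem inDomain_log_sub (a : ℝ) : InDomain a fun t => (Real.log (a - t) : ℂ) :=
  inDomain_of_hasDerivAt hasDerivAt_log_sub
    (Complex.ofRealCLM.contDiff.comp (by fun_prop : ContDiff ℝ 1 fun t : ℝ => -(a + t) / a ^ 2))
    (memLp_log_sub a)

/-! ### Boundary values on the maximal domain. -/

theorem InDomain.integrable_green {a : ℝ} {x y : ℝ → ℂ} (hx : InDomain a x) (hy : InDomain a y) :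
    Integrable (fun t => formalL a x t * y t - x t * formalL a y t) (mu a) :=
  (hx.memLp_formalL.integrable_mul hy.memLp).sub (hx.memLp.integrable_mul hy.memLp_formalL)

/-- The Wronskian of two functions of the maximal domain has limits at both endpoints, and their
difference is given by Green's formula. -/
theorem InDomain.exists_wronskian_limits {a : ℝ} (ha : 0 < a) {x y : ℝ → ℂ} (hx : InDomain a x)
    (hy : InDomain a y) : ∃ lm lp : ℂ,
      Tendsto (wronskian a x y) (𝓝[Ioo (-a) a] (-a)) (𝓝 lm) ∧
      Tendsto (wronskian a x y) (𝓝[Ioo (-a) a] a) (𝓝 lp) ∧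
      ∫ t, (formalL a x t * y t - x t * formalL a y t) ∂mu a = lp - lm := by
  set f : ℝ → ℂ := fun t => formalL a x t * y t - x t * formalL a y t with hf_def
  have hf : Integrable f (mu a) := hx.integrable_green hy
  have h0 : (0 : ℝ) ∈ Ioo (-a) a := ⟨by linarith, ha⟩
  have haa : -a ≤ a := by linarith
  have hi : IntervalIntegrable f volume (-a) a :=
    (intervalIntegrable_iff_integrableOn_Ioo_of_le haa).2 hf
  -- Inside the interval the Wronskian is a primitive of an integrable function, and such a
  -- primitive is continuous up to both endpoints.
  have hc : ContinuousOn (fun t => wronskian a x y 0 + ∫ s in (0 : ℝ)..t, f s) (Icc (-a) a) := by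
    rw [← uIcc_of_le haa]
    refine continuousOn_const.add (intervalIntegral.continuousOn_primitive_interval' hi ?_)
    rw [uIcc_of_le haa]
    exact Ioo_subset_Icc_self h0
  have hw : ∀ t ∈ Ioo (-a) a,
      wronskian a x y 0 + ∫ s in (0 : ℝ)..t, f s = wronskian a x y t := by
    intro t ht
    rcases le_total 0 t with h | h
    · rw [green hx.classA hy.classA h0.1 h ht.2 (intervalIntegrable_of_integrable hf h0 ht)]
      ring
    · rw [intervalIntegral.integral_symm,
        green hx.classA hy.classA ht.1 h h0.2 (intervalIntegrable_of_integrable hf ht h0)]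
      ring
  refine ⟨wronskian a x y 0 + ∫ s in (0 : ℝ)..(-a), f s,
    wronskian a x y 0 + ∫ s in (0 : ℝ)..a, f s, ?_, ?_, ?_⟩
  · exact ((hc (-a) (left_mem_Icc.2 haa)).tendsto.mono_left
      (nhdsWithin_mono _ Ioo_subset_Icc_self)).congr' (eventually_mem_nhdsWithin.mono hw)
  · exact ((hc a (right_mem_Icc.2 haa)).tendsto.mono_left
      (nhdsWithin_mono _ Ioo_subset_Icc_self)).congr' (eventually_mem_nhdsWithin.mono hw)
  · rw [← integral_Ioc_eq_integral_Ioo, ← intervalIntegral.integral_of_le haa,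
      ← intervalIntegral.integral_add_adjacent_intervals (b := 0)
        (hi.mono_set (uIcc_subset_uIcc left_mem_uIcc ?_))
        (hi.mono_set (uIcc_subset_uIcc ?_ right_mem_uIcc)),
      intervalIntegral.integral_symm 0 (-a)]
    · ring
    all_goals
      rw [uIcc_of_le haa]
      exact Ioo_subset_Icc_self h0

theorem tendsto_ofReal_nhdsWithin {g : ℝ → ℝ} {s : Set ℝ} {c : ℝ} (hg : ContinuousAt g c) :
    Tendsto (fun t => (g t : ℂ)) (𝓝[s] c) (𝓝 (g c : ℂ)) :=
  ((Complex.continuous_ofReal.tendsto _).comp hg.tendsto).mono_left nhdsWithin_le_nhds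

/-- The generalized boundary values exist on the maximal domain. -/
theorem InDomain.exists_boundaryValues {a : ℝ} (ha : 0 < a) {x : ℝ → ℂ} (hx : InDomain a x) :
    ∃ bm cm bp cp : ℂ, HasBoundaryValues a x bm cm bp cp := by
  -- The Wronskian with 1 is -px', and p is a factor nonzero at the chosen endpoint times the
  -- distance to that endpoint. Dividing by this factor gives b; the Wronskian with the logarithm
  -- singular there gives c in the same way.
  obtain ⟨l1, r1, hl1, hr1, -⟩ := hx.exists_wronskian_limits ha (inDomain_one a)
  obtain ⟨l2, -, hl2, -, -⟩ := hx.exists_wronskian_limits ha (inDomain_log_add a)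
  obtain ⟨-, r3, -, hr3, -⟩ := hx.exists_wronskian_limits ha (inDomain_log_sub a)
  have hm : Tendsto (fun t : ℝ => ((a ^ 2 / (a - t) : ℝ) : ℂ)) (𝓝[Ioo (-a) a] (-a))
      (𝓝 ((a ^ 2 / (a - -a) : ℝ) : ℂ)) := by
    refine tendsto_ofReal_nhdsWithin (ContinuousAt.div (by fun_prop) (by fun_prop) ?_)
    linarith
  have hp : Tendsto (fun t : ℝ => ((a ^ 2 / (a + t) : ℝ) : ℂ)) (𝓝[Ioo (-a) a] a)
      (𝓝 ((a ^ 2 / (a + a) : ℝ) : ℂ)) := by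
    refine tendsto_ofReal_nhdsWithin (ContinuousAt.div (by fun_prop) (by fun_prop) ?_)
    linarith
  have hne : ∀ t ∈ Ioo (-a) a, (a : ℂ) - t ≠ 0 ∧ (a : ℂ) + t ≠ 0 := fun t ht => by
    constructor
    · exact_mod_cast (by linarith [ht.2] : a - t ≠ 0)
    · exact_mod_cast (by linarith [ht.1] : a + t ≠ 0)
  have hac : (a : ℂ) ≠ 0 := by exact_mod_cast ha.ne'
  refine ⟨_, _, _, _, (hm.mul hl1).neg.congr' ?_, (hm.mul hl2).neg.congr' ?_,
    (hp.mul hr1).congr' ?_, (hp.mul hr3).congr' ?_⟩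
  · filter_upwards [self_mem_nhdsWithin] with t ht
    obtain ⟨h1, h2⟩ := hne t ht
    rw [wronskian, flux_eq (hasDerivAt_one a) ht, flux, weight_eq ha]
    push_cast
    field_simp
    ring
  · filter_upwards [self_mem_nhdsWithin] with t ht
    obtain ⟨h1, h2⟩ := hne t ht
    rw [wronskian, flux_eq hasDerivAt_log_add ht, flux, weight_eq ha]
    push_cast
    field_simp
    ring
  · filter_upwards [self_mem_nhdsWithin] with t ht
    obtain ⟨h1, h2⟩ := hne t ht
    rw [wronskian, flux_eq (hasDerivAt_one a) ht, flux, weight_eq ha]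
    push_cast
    field_simp
    ring
  · filter_upwards [self_mem_nhdsWithin] with t ht
    obtain ⟨h1, h2⟩ := hne t ht
    rw [wronskian, flux_eq hasDerivAt_log_sub ht, flux, weight_eq ha]
    push_cast
    field_simp
    ring

theorem neBot_left {a : ℝ} (ha : 0 < a) : (𝓝[Ioo (-a) a] (-a)).NeBot :=
  left_nhdsWithin_Ioo_neBot (by linarith)

theorem neBot_right {a : ℝ} (ha : 0 < a) : (𝓝[Ioo (-a) a] a).NeBot :=
  right_nhdsWithin_Ioo_neBot (by linarith)

/-- Green's formula in terms of the boundary values. -/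
theorem InDomain.integral_green {a : ℝ} (ha : 0 < a) {x y : ℝ → ℂ} (hx : InDomain a x)
    (hy : InDomain a y) {bm cm bp cp bm' cm' bp' cp' : ℂ} (h : HasBoundaryValues a x bm cm bp cp)
    (h' : HasBoundaryValues a y bm' cm' bp' cp') :
    ∫ t, (formalL a x t * y t - x t * formalL a y t) ∂mu a =
      -(2 / a) * ((bm * cm' - cm * bm') + (bp * cp' - cp * bp')) := by
  obtain ⟨lm, lp, hlm, hlp, hint⟩ := hx.exists_wronskian_limits ha hy
  have := neBot_left ha
  have := neBot_right ha
  have hac : (a : ℂ) ≠ 0 := by exact_mod_cast ha.ne'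
  -- Before the limit the identity is exact: in bc' - cb' the logarithmic terms cancel, leaving
  -- (t+a)(xy' - x'y). The other endpoint behaves likewise.
  have h1 : Tendsto (wronskian a x y) (𝓝[Ioo (-a) a] (-a))
      (𝓝 ((((a - -a) / a ^ 2 : ℝ) : ℂ) * (bm * cm' - cm * bm'))) := by
    refine ((tendsto_ofReal_nhdsWithin (g := fun t => (a - t) / a ^ 2) (by fun_prop)).mul
      ((h.bm_lim.mul h'.cm_lim).sub (h.cm_lim.mul h'.bm_lim))).congr fun t => ?_
    rw [wronskian, flux, flux, weight_eq ha]
    push_cast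
    field_simp
    ring
  have h2 : Tendsto (wronskian a x y) (𝓝[Ioo (-a) a] a)
      (𝓝 (((-(a + a) / a ^ 2 : ℝ) : ℂ) * (bp * cp' - cp * bp'))) := by
    refine ((tendsto_ofReal_nhdsWithin (g := fun t => -(a + t) / a ^ 2) (by fun_prop)).mul
      ((h.bp_lim.mul h'.cp_lim).sub (h.cp_lim.mul h'.bp_lim))).congr fun t => ?_
    rw [wronskian, flux, flux, weight_eq ha]
    push_cast
    field_simp
    ring
  rw [hint, tendsto_nhds_unique hlm h1, tendsto_nhds_unique hlp h2]
  push_cast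
  field_simp
  ring

theorem HasBoundaryValues.unique {a : ℝ} (ha : 0 < a) {x y : ℝ → ℂ} (hxy : EqOn x y (Ioo (-a) a))
    {bm cm bp cp bm' cm' bp' cp' : ℂ} (h : HasBoundaryValues a x bm cm bp cp)
    (h' : HasBoundaryValues a y bm' cm' bp' cp') :
    bm = bm' ∧ cm = cm' ∧ bp = bp' ∧ cp = cp' := by
  have := neBot_left ha
  have := neBot_right ha
  have hd : ∀ t ∈ Ioo (-a) a, deriv x t = deriv y t := fun t ht =>
    (hxy.eventuallyEq_of_mem (isOpen_Ioo.mem_nhds ht)).deriv_eq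
  refine ⟨tendsto_nhds_unique h.bm_lim (h'.bm_lim.congr' ?_),
    tendsto_nhds_unique h.cm_lim (h'.cm_lim.congr' ?_),
    tendsto_nhds_unique h.bp_lim (h'.bp_lim.congr' ?_),
    tendsto_nhds_unique h.cp_lim (h'.cp_lim.congr' ?_)⟩ <;>
  · filter_upwards [self_mem_nhdsWithin] with t ht
    simp only [hd t ht, hxy ht]

theorem deriv_log_add {a t : ℝ} (ht : t ∈ Ioo (-a) a) :
    deriv (fun t : ℝ => (Real.log (a + t) : ℂ)) t = ((a + t)⁻¹ : ℝ) := by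
  have h2 : a + t ≠ 0 := by linarith [ht.1]
  simpa using (((hasDerivAt_id t).const_add a).log h2).ofReal_comp.deriv

theorem deriv_log_sub {a t : ℝ} (ht : t ∈ Ioo (-a) a) :
    deriv (fun t : ℝ => (Real.log (a - t) : ℂ)) t = ((t - a)⁻¹ : ℝ) := by
  have h1 : a - t ≠ 0 := by linarith [ht.2]
  have h := (((hasDerivAt_id t).const_sub a).log h1).ofReal_comp.deriv
  refine h.trans ?_
  congr 1
  rw [← neg_sub a t, inv_neg, id, neg_div, one_div]

theorem tendsto_of_eqOn {g : ℝ → ℝ} {F : ℝ → ℂ} {s : Set ℝ} {c : ℝ} {l : ℂ} (hg : ContinuousAt g c)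
    (h : ∀ t ∈ s, (g t : ℂ) = F t) (hl : (g c : ℂ) = l) : Tendsto F (𝓝[s] c) (𝓝 l) :=
  hl ▸ (tendsto_ofReal_nhdsWithin hg).congr' (eventually_mem_nhdsWithin.mono h)

theorem continuousAt_mul_log_add (a c : ℝ) :
    ContinuousAt (fun t => (t + a) * Real.log (a + t)) c := by
  have h := Real.continuous_mul_log.comp (continuous_const_add a)
  simp only [Function.comp_def] at h
  simpa only [add_comm] using h.continuousAt

theorem continuousAt_mul_log_sub (a c : ℝ) :
    ContinuousAt (fun t => (t - a) * Real.log (a - t)) c := by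
  have h : Continuous fun t => (a - t) * Real.log (a - t) :=
    Real.continuous_mul_log.comp (by fun_prop : Continuous fun t : ℝ => a - t)
  have e : (fun t => (t - a) * Real.log (a - t)) = fun t => -((a - t) * Real.log (a - t)) := by
    ext t
    ring
  rw [e]
  exact h.neg.continuousAt

theorem hasBoundaryValues_one (a : ℝ) : HasBoundaryValues a (fun _ => 1) 0 (-1) 0 (-1) := by
  constructor <;> simp [tendsto_const_nhds]

theorem deriv_ofReal (t : ℝ) : deriv (fun t : ℝ => (t : ℂ)) t = 1 :=
  (hasDerivAt_id t).ofReal_comp.deriv.trans Complex.ofReal_one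

theorem hasBoundaryValues_id (a : ℝ) : HasBoundaryValues a (fun t => (t : ℂ)) 0 a 0 (-a) := by
  constructor
  · exact tendsto_of_eqOn (g := fun t => t + a) (by fun_prop) (fun t _ => by simp [deriv_ofReal])
      (by simp)
  · exact tendsto_of_eqOn (g := fun t => (t + a) * Real.log (a + t) - t)
      ((continuousAt_mul_log_add a _).sub continuousAt_id) (fun t _ => by simp [deriv_ofReal])
      (by simp)
  · exact tendsto_of_eqOn (g := fun t => t - a) (by fun_prop) (fun t _ => by simp [deriv_ofReal])
      (by simp)
  · exact tendsto_of_eqOn (g := fun t => (t - a) * Real.log (a - t) - t)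
      ((continuousAt_mul_log_sub a _).sub continuousAt_id) (fun t _ => by simp [deriv_ofReal])
      (by simp)

theorem hasBoundaryValues_log_add {a : ℝ} (ha : 0 < a) :
    HasBoundaryValues a (fun t => (Real.log (a + t) : ℂ)) 1 0 0 (-Real.log (2 * a)) := by
  have h2 : ∀ t ∈ Ioo (-a) a, a + t ≠ 0 := fun t ht => by linarith [ht.1]
  constructor
  · refine tendsto_of_eqOn (g := fun _ => 1) (by fun_prop) (fun t ht => ?_) (by simp)
    rw [deriv_log_add ht, ← Complex.ofReal_mul, add_comm t, mul_inv_cancel₀ (h2 t ht)]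
  · refine tendsto_of_eqOn (g := fun _ => 0) (by fun_prop) (fun t ht => ?_) (by simp)
    rw [deriv_log_add ht, ← Complex.ofReal_mul, ← Complex.ofReal_sub]
    have := h2 t ht
    congr 1
    field_simp
    ring
  · refine tendsto_of_eqOn (g := fun t => (t - a) * (a + t)⁻¹)
      (ContinuousAt.mul (by fun_prop) (ContinuousAt.inv₀ (by fun_prop) (by linarith)))
      (fun t ht => ?_) (by simp)
    rw [deriv_log_add ht, ← Complex.ofReal_mul]
  · refine tendsto_of_eqOn (g := fun t => (t - a) * Real.log (a - t) * (a + t)⁻¹ - Real.log (a + t))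
      (((continuousAt_mul_log_sub a a).mul (ContinuousAt.inv₀ (by fun_prop) (by linarith))).sub
        (ContinuousAt.log (by fun_prop) (by linarith)))
      (fun t ht => ?_) (by simp [two_mul])
    rw [deriv_log_add ht, ← Complex.ofReal_mul, ← Complex.ofReal_sub]

theorem hasBoundaryValues_log_sub {a : ℝ} (ha : 0 < a) :
    HasBoundaryValues a (fun t => (Real.log (a - t) : ℂ)) 0 (-Real.log (2 * a)) 1 0 := by
  have h2 : ∀ t ∈ Ioo (-a) a, t - a ≠ 0 := fun t ht => by linarith [ht.2]
  constructor
  · refine tendsto_of_eqOn (g := fun t => (t + a) * (t - a)⁻¹)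
      (ContinuousAt.mul (by fun_prop) (ContinuousAt.inv₀ (by fun_prop) (by linarith)))
      (fun t ht => ?_) (by simp)
    rw [deriv_log_sub ht, ← Complex.ofReal_mul]
  · refine tendsto_of_eqOn (g := fun t => (t + a) * Real.log (a + t) * (t - a)⁻¹ - Real.log (a - t))
      (((continuousAt_mul_log_add a (-a)).mul (ContinuousAt.inv₀ (by fun_prop) (by linarith))).sub
        (ContinuousAt.log (by fun_prop) (by linarith)))
      (fun t ht => ?_) (by simp [two_mul])
    rw [deriv_log_sub ht, ← Complex.ofReal_mul, ← Complex.ofReal_sub]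
  · refine tendsto_of_eqOn (g := fun _ => 1) (by fun_prop) (fun t ht => ?_) (by simp)
    rw [deriv_log_sub ht, ← Complex.ofReal_mul, mul_inv_cancel₀ (h2 t ht)]
  · refine tendsto_of_eqOn (g := fun _ => 0) (by fun_prop) (fun t ht => ?_) (by simp)
    rw [deriv_log_sub ht, ← Complex.ofReal_mul, ← Complex.ofReal_sub]
    have := h2 t ht
    congr 1
    field_simp
    ring

/-- The boundary values take all values in `ℂ⁴`. -/
theorem exists_inDomain_hasBoundaryValues {a : ℝ} (ha : 0 < a) (bm cm bp cp : ℂ) :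
    ∃ x, InDomain a x ∧ HasBoundaryValues a x bm cm bp cp := by
  have hac : (a : ℂ) ≠ 0 := by exact_mod_cast ha.ne'
  set l : ℂ := (Real.log (2 * a) : ℂ)
  have d1 := inDomain_log_add a
  have d2 := inDomain_log_sub a
  have d3 := inDomain_one a
  have d4 := inDomain_id a
  have e12 := ((hasBoundaryValues_log_add ha).smul bm d1.classA).add (d1.smul bm).classA
    (d2.smul bp).classA ((hasBoundaryValues_log_sub ha).smul bp d2.classA)
  -- The logarithms already produce the right b, but contribute -l·bp and -l·bm to the two c. The
  -- correction c1 + c2·t has zero b and must supply -c1 + a·c2 = cm + l·bp and -c1 - a·c2 = cp +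
  -- l·bm.
  set c1 : ℂ := -((cm + l * bp) + (cp + l * bm)) / 2
  set c2 : ℂ := ((cm + l * bp) - (cp + l * bm)) / (2 * a)
  have e34 := ((hasBoundaryValues_one a).smul c1 d3.classA).add (d3.smul c1).classA
    (d4.smul c2).classA ((hasBoundaryValues_id a).smul c2 d4.classA)
  refine ⟨_, ((d1.smul bm).add (d2.smul bp)).add ((d3.smul c1).add (d4.smul c2)), ?_⟩
  have e := e12.add ((d1.smul bm).add (d2.smul bp)).classA
    ((d3.smul c1).add (d4.smul c2)).classA e34
  convert e using 1
  · ring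
  · simp only [c1, c2]; field_simp; ring
  · ring
  · simp only [c1, c2]; field_simp; ring

/-! ### Weak solutions are strong. -/

/-- The continuous functions that vanish outside some interval `(-r, r)` with `r < a`. -/
def testSpace (a : ℝ) : Submodule ℂ (ℝ → ℂ) where
  carrier := {ψ | Continuous ψ ∧ ∃ r < a, ∀ t ∉ Ioo (-r) r, ψ t = 0}
  zero_mem' := ⟨continuous_zero, a - 1, by linarith, fun _ _ => rfl⟩
  add_mem' := by
    rintro ψ φ ⟨h1, r, hra, h2⟩ ⟨h3, s, hsa, h4⟩
    refine ⟨h1.add h3, max r s, max_lt hra hsa, fun t ht => ?_⟩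
    have h5 : Ioo (-r) r ⊆ Ioo (-max r s) (max r s) :=
      Ioo_subset_Ioo (neg_le_neg (le_max_left _ _)) (le_max_left _ _)
    have h6 : Ioo (-s) s ⊆ Ioo (-max r s) (max r s) :=
      Ioo_subset_Ioo (neg_le_neg (le_max_right _ _)) (le_max_right _ _)
    rw [Pi.add_apply, h2 t fun h => ht (h5 h), h4 t fun h => ht (h6 h), add_zero]
  smul_mem' := by
    rintro c ψ ⟨h1, r, hra, h2⟩
    exact ⟨h1.const_smul c, r, hra, fun t ht => by rw [Pi.smul_apply, h2 t ht, smul_zero]⟩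

theorem exists_radius {a : ℝ} (ha : 0 < a) {ψ : ℝ → ℂ} (hψ : ψ ∈ testSpace a) :
    Continuous ψ ∧ ∃ r, 0 < r ∧ r < a ∧ ∀ t ∉ Ioo (-r) r, ψ t = 0 := by
  obtain ⟨h1, r, hra, h2⟩ := hψ
  refine ⟨h1, max r (a / 2), lt_max_of_lt_right (by linarith), max_lt hra (by linarith),
    fun t ht => h2 t fun h => ht ?_⟩
  exact Ioo_subset_Ioo (neg_le_neg (le_max_left _ _)) (le_max_left _ _) h

theorem exists_radius_of_isCompact {a : ℝ} (ha : 0 < a) {K : Set ℝ} (hK : IsCompact K)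
    (hKI : K ⊆ Ioo (-a) a) : ∃ r, 0 < r ∧ r < a ∧ K ⊆ Ioo (-r) r := by
  rcases K.eq_empty_or_nonempty with rfl | hne
  · exact ⟨a / 2, by linarith, by linarith, empty_subset _⟩
  · obtain ⟨s, hs, hmax⟩ := hK.exists_isMaxOn hne continuous_abs.continuousOn
    have h1 : |s| < a := abs_lt.2 (hKI hs)
    have h2 := abs_nonneg s
    refine ⟨(|s| + a) / 2, by linarith, by linarith, fun t ht => ?_⟩
    have h3 : |t| ≤ |s| := hmax ht
    exact abs_lt.1 (by linarith)

theorem ofReal_comp_mem_testSpace {a : ℝ} (ha : 0 < a) {g : ℝ → ℝ} (hg : Continuous g)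
    (hc : HasCompactSupport g) (hs : tsupport g ⊆ Ioo (-a) a) :
    (fun t => (g t : ℂ)) ∈ testSpace a := by
  obtain ⟨r, -, hra, h⟩ := exists_radius_of_isCompact ha hc.isCompact hs
  refine ⟨Complex.continuous_ofReal.comp hg, r, hra, fun t ht => ?_⟩
  beta_reduce
  rw [image_eq_zero_of_notMem_tsupport fun h' => ht (h h'), Complex.ofReal_zero]

theorem Icc_subset_of_lt {a r : ℝ} (hra : r < a) : Icc (-r) r ⊆ Ioo (-a) a :=
  Icc_subset_interval (by linarith) hra

theorem integral_eq_of_vanish {a r : ℝ} (hr : 0 < r) (hra : r < a) {f : ℝ → ℂ}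
    (h : ∀ t ∈ Ioo (-a) a, t ∉ Ioo (-r) r → f t = 0) :
    ∫ t, f t ∂mu a = ∫ t in (-r)..r, f t := by
  rw [intervalIntegral.integral_of_le (by linarith), integral_Ioc_eq_integral_Ioo]
  exact setIntegral_eq_of_subset_of_forall_sdiff_eq_zero measurableSet_Ioo
    (Ioo_subset_Icc_self.trans (Icc_subset_of_lt hra)) fun t ht => h t ht.1 ht.2

theorem integrable_test_mul {a : ℝ} (ha : 0 < a) {ψ g : ℝ → ℂ} (hψ : ψ ∈ testSpace a)
    (hg : LocallyIntegrableOn g (Ioo (-a) a)) : Integrable (fun t => ψ t * g t) (mu a) := by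
  obtain ⟨h1, r, hr, hra, h2⟩ := exists_radius ha hψ
  have h3 : IntegrableOn g (Icc (-r) r) :=
    hg.integrableOn_compact_subset (Icc_subset_of_lt hra) isCompact_Icc
  refine (h3.continuousOn_mul h1.continuousOn isCompact_Icc).of_forall_sdiff_eq_zero
    measurableSet_Ioo fun t ht => ?_
  rw [h2 t fun h => ht.2 (Ioo_subset_Icc_self h), zero_mul]

/-- Integration of test functions against a locally integrable function. -/
def testFunctional {a : ℝ} (ha : 0 < a) (g : ℝ → ℂ) (hg : LocallyIntegrableOn g (Ioo (-a) a)) :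
    testSpace a →ₗ[ℂ] ℂ where
  toFun ψ := ∫ t, ψ.1 t * g t ∂mu a
  map_add' ψ φ := by
    rw [← integral_add (integrable_test_mul ha ψ.2 hg) (integrable_test_mul ha φ.2 hg)]
    simp only [Submodule.coe_add, Pi.add_apply, add_mul]
  map_smul' c ψ := by
    rw [RingHom.id_apply, smul_eq_mul, ← integral_const_mul]
    simp only [Submodule.coe_smul, Pi.smul_apply, smul_eq_mul, mul_assoc]

theorem ae_eq_zero_of_integral_smooth_mul {a : ℝ} {g : ℝ → ℂ}
    (hg : LocallyIntegrableOn g (Ioo (-a) a))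
    (h : ∀ φ : ℝ → ℝ, ContDiff ℝ (⊤ : ℕ∞) φ → HasCompactSupport φ → tsupport φ ⊆ Ioo (-a) a →
      ∫ t, (φ t : ℂ) * g t ∂mu a = 0) : g =ᵐ[mu a] 0 := by
  have h1 := isOpen_Ioo.ae_eq_zero_of_integral_contDiff_smul_eq_zero hg fun φ h1 h2 h3 => by
    rw [← h φ h1 h2 h3]
    symm
    simp only [← Complex.real_smul]
    refine setIntegral_eq_integral_of_forall_compl_eq_zero fun t ht => ?_
    rw [image_eq_zero_of_notMem_tsupport fun h' => ht (h3 h'), zero_smul]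
  exact (ae_restrict_iff' measurableSet_Ioo).2 h1

theorem integrable_zero (a : ℝ) : Integrable (fun _ : ℝ => (0 : ℂ)) (mu a) :=
  integrable_const 0

/-- The solution of `(1 - t² / a²) x' = 1` that vanishes at `0`. -/
abbrev unitFlux (a : ℝ) : ℝ → ℂ := primitive a (fun _ => 0) 1 0

/-- Changing the two constants adds a solution c·`unitFlux` + d of the homogeneous equation (px')' =
0. -/
theorem primitive_eq {a : ℝ} {f : ℝ → ℂ} (hf : Integrable f (mu a)) (c d : ℂ) {t : ℝ}
    (ht : t ∈ Ioo (-a) a) :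
    primitive a f c d t = primitive a f 0 0 t + (c * unitFlux a t + d) := by
  have h0 := zero_mem_interval ht
  have hs := uIcc_subset_interval h0 ht
  have h1 := ((continuousOn_primitive_deriv hf 0).mono hs).intervalIntegrable (μ := volume)
  have h2 := ((continuousOn_primitive_deriv (integrable_zero a) 1).mono hs).intervalIntegrable
    (μ := volume)
  simp only [primitive, zero_add]
  rw [← intervalIntegral.integral_const_mul, ← add_assoc,
    ← intervalIntegral.integral_add (by simpa only [zero_add] using h1) (h2.const_mul c), add_comm]
  congr 1
  refine intervalIntegral.integral_congr fun s _ => ?_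
  simp only [intervalIntegral.integral_zero]
  ring

theorem flux_primitive {a : ℝ} {f : ℝ → ℂ} (hf : Integrable f (mu a)) (c d : ℂ) {t : ℝ}
    (ht : t ∈ Ioo (-a) a) : flux a (primitive a f c d) t = c + ∫ s in (0 : ℝ)..t, f s :=
  flux_eq (fun _ ht => hasDerivAt_primitive hf c d ht) ht

theorem intervalIntegral_eq_zero_of_forall {f : ℝ → ℂ} {α β : ℝ} (h : ∀ t ∈ uIcc α β, f t = 0) :
    ∫ t in α..β, f t = 0 := by
  rw [intervalIntegral.integral_congr (g := fun _ => 0) fun t ht => h t ht]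
  exact intervalIntegral.integral_zero

/-- Green's formula between solutions of inhomogeneous equations. -/
theorem green_primitive {a r : ℝ} (hr : 0 < r) (hra : r < a) {ψ f : ℝ → ℂ}
    (hψ : Integrable ψ (mu a)) (hf : Integrable f (mu a)) (c d c' d' : ℂ) :
    ∫ t in (-r)..r, (primitive a ψ c d t * f t - ψ t * primitive a f c' d' t) =
      wronskian a (primitive a ψ c d) (primitive a f c' d') r -
        wronskian a (primitive a ψ c d) (primitive a f c' d') (-r) := by
  have hm : -r ∈ Ioo (-a) a := ⟨by linarith, by linarith⟩
  have hp : r ∈ Ioo (-a) a := ⟨by linarith, by linarith⟩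
  have hx := classA_primitive hψ c d
  have hy := classA_primitive hf c' d'
  have hs := uIcc_subset_interval hm hp
  have hi : IntervalIntegrable
      (fun t => primitive a ψ c d t * f t - ψ t * primitive a f c' d' t) volume (-r) r :=
    ((intervalIntegrable_of_integrable hf hm hp).continuousOn_mul (hx.continuousOn.mono hs)).sub
      ((intervalIntegrable_of_integrable hψ hm hp).mul_continuousOn (hy.continuousOn.mono hs))
  have h1 := formalL_primitive hψ c d
  have h2 := formalL_primitive hf c' d'
  rw [ae_restrict_iff' measurableSet_Ioo] at h1 h2
  have h3 : ∀ᵐ t, t ∈ uIoc (-r) r →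
      primitive a ψ c d t * f t - ψ t * primitive a f c' d' t =
      formalL a (primitive a ψ c d) t * primitive a f c' d' t -
        primitive a ψ c d t * formalL a (primitive a f c' d') t := by
    filter_upwards [h1, h2] with t h1 h2 ht
    have ht' := hs (uIoc_subset_uIcc ht)
    rw [h1 ht', h2 ht']
    ring
  rw [intervalIntegral.integral_congr_ae h3]
  exact green hx hy hm.1 (by linarith) hp.2
    (hi.congr_ae ((ae_restrict_iff' measurableSet_uIoc).2 h3))

/-- A test function orthogonal to the solutions `1` and `unitFlux` of the homogeneous equation
is the image of a compactly supported function. -/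
theorem exists_compact_solution {a : ℝ} (ha : 0 < a) {ψ : ℝ → ℂ} (hψ : ψ ∈ testSpace a)
    (h1 : ∫ t, ψ t * 1 ∂mu a = 0) (h2 : ∫ t, ψ t * unitFlux a t ∂mu a = 0) :
    ∃ c d : ℂ, ∃ r, 0 < r ∧ r < a ∧ (∀ t ∉ Ioo (-r) r, ψ t = 0) ∧
      (∀ t ∈ Ioo (-a) a, t ∉ Ioo (-r) r →
        primitive a ψ c d t = 0 ∧ flux a (primitive a ψ c d) t = 0) := by
  obtain ⟨hc, r, hr, hra, hv⟩ := exists_radius ha hψ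
  have hψi : Integrable ψ (mu a) := (memLp_of_continuous a hc).integrable one_le_two
  have hii : ∀ s t : ℝ, IntervalIntegrable ψ volume s t := fun s t => hc.intervalIntegrable s t
  have hm : -r ∈ Ioo (-a) a := ⟨by linarith, by linarith⟩
  have hp : r ∈ Ioo (-a) a := ⟨by linarith, by linarith⟩
  have h0 : (0 : ℝ) ∈ Ioo (-a) a := ⟨by linarith, ha⟩
  have hI : ∫ t in (-r)..r, ψ t = 0 := by
    rw [← integral_eq_of_vanish hr hra fun t _ ht => hv t ht]
    simpa using h1
  -- With this constant the quasi-derivative is the integral of ψ from -r. It vanishes left of -r,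
  -- and right of r because ψ has integral 0.
  set c : ℂ := ∫ t in (-r)..0, ψ t with hc_def
  have hq : ∀ t, c + ∫ s in (0 : ℝ)..t, ψ s = ∫ s in (-r)..t, ψ s := fun t =>
    intervalIntegral.integral_add_adjacent_intervals (hii _ _) (hii _ _)
  have hqm : ∀ t ≤ -r, c + ∫ s in (0 : ℝ)..t, ψ s = 0 := fun t ht => by
    rw [hq]
    refine intervalIntegral_eq_zero_of_forall fun s hs => hv s fun hs' => ?_
    rw [uIcc_of_ge ht] at hs
    exact hs'.1.not_ge hs.2
  have hqp : ∀ t, r ≤ t → c + ∫ s in (0 : ℝ)..t, ψ s = 0 := fun t ht => by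
    rw [hq, ← intervalIntegral.integral_add_adjacent_intervals (hii (-r) r) (hii r t), hI, zero_add]
    refine intervalIntegral_eq_zero_of_forall fun s hs => hv s fun hs' => ?_
    rw [uIcc_of_le ht] at hs
    exact hs'.2.not_ge hs.1
  set Q : ℝ → ℂ := fun s => (c + ∫ r in (0 : ℝ)..s, ψ r) / (weight a s : ℂ) with hQ
  have hQi : ∀ {s t : ℝ}, s ∈ Ioo (-a) a → t ∈ Ioo (-a) a → IntervalIntegrable Q volume s t :=
    fun hs ht =>
      ((continuousOn_primitive_deriv hψi c).mono (uIcc_subset_interval hs ht)).intervalIntegrable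
  -- Likewise this value at 0 makes the solution vanish left of -r.
  set d : ℂ := ∫ s in (-r)..0, Q s with hd
  have hx : ∀ t ∈ Ioo (-a) a, primitive a ψ c d t = ∫ s in (-r)..t, Q s := fun t ht =>
    intervalIntegral.integral_add_adjacent_intervals (hQi hm h0) (hQi h0 ht)
  have hxm : ∀ t ∈ Ioo (-a) a, t ≤ -r → primitive a ψ c d t = 0 := fun t ht htr => by
    rw [hx t ht]
    refine intervalIntegral_eq_zero_of_forall fun s hs => ?_
    rw [uIcc_of_ge htr] at hs
    simp only [hQ, hqm s hs.2, zero_div]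
  have hflux : ∀ t ∈ Ioo (-a) a, t ∉ Ioo (-r) r → flux a (primitive a ψ c d) t = 0 := by
    intro t ht htr
    rw [flux_primitive hψi c d ht]
    rcases le_or_gt t (-r) with h | h
    · exact hqm t h
    · exact hqp t (not_lt.1 fun h' => htr ⟨h, h'⟩)
  -- In Green's formula against `unitFlux` the only surviving boundary term is x(r), and the
  -- integral is zero by the second orthogonality condition.
  have hxr : primitive a ψ c d r = 0 := by
    have h3 := green_primitive hr hra hψi (integrable_zero a) c d 1 0
    rw [wronskian, wronskian, hflux r hp fun h => h.2.ne rfl, hflux (-r) hm fun h => h.1.ne rfl,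
      hxm (-r) hm le_rfl, flux_primitive (integrable_zero a) 1 0 hp] at h3
    simp only [mul_zero, zero_sub, intervalIntegral.integral_neg, intervalIntegral.integral_zero,
      add_zero, mul_one, zero_mul, sub_zero] at h3
    rw [← h3, ← integral_eq_of_vanish hr hra fun t _ ht => by rw [hv t ht, zero_mul], h2, neg_zero]
  refine ⟨c, d, r, hr, hra, hv, fun t ht htr => ⟨?_, hflux t ht htr⟩⟩
  rcases le_or_gt t (-r) with h | h
  · exact hxm t ht h
  · have hrt : r ≤ t := not_lt.1 fun h' => htr ⟨h, h'⟩
    rw [hx t ht, ← intervalIntegral.integral_add_adjacent_intervals (hQi hm hp) (hQi hp ht),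
      ← hx r hp, hxr, zero_add]
    refine intervalIntegral_eq_zero_of_forall fun s hs => ?_
    rw [uIcc_of_le hrt] at hs
    simp only [hQ, hqp s hs.1, zero_div]

theorem memLp_of_vanish {a r : ℝ} (hr : 0 < r) (hra : r < a) {x : ℝ → ℂ}
    (hx : ContinuousOn x (Ioo (-a) a)) (h : ∀ t ∈ Ioo (-a) a, t ∉ Ioo (-r) r → x t = 0) :
    MemLp x 2 (mu a) := by
  obtain ⟨C, hC⟩ := (isCompact_Icc (a := -r) (b := r)).exists_bound_of_continuousOn
    (hx.mono (Icc_subset_of_lt hra))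
  refine MemLp.of_bound (hx.aestronglyMeasurable measurableSet_Ioo) C ?_
  filter_upwards [ae_restrict_mem measurableSet_Ioo] with t ht
  by_cases htr : t ∈ Ioo (-r) r
  · exact hC t (Ioo_subset_Icc_self htr)
  · rw [h t ht htr, norm_zero]
    exact (norm_nonneg _).trans (hC 0 ⟨by linarith, hr.le⟩)

/-- Weak solutions are strong solutions: the adjoint of the restriction to compactly supported
functions is contained in the maximal operator. -/
theorem exists_classA_of_weak_solution {a : ℝ} (ha : 0 < a) {u v : ℝ → ℂ} (hu : MemLp u 2 (mu a))
    (hv : MemLp v 2 (mu a))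
    (h : ∀ x, ClassA₀ a x → InDomain a x → ∫ t, formalL a x t * u t ∂mu a = ∫ t, x t * v t ∂mu a) :
    ∃ y, ClassA a y ∧ u =ᵐ[mu a] y ∧ v =ᵐ[mu a] formalL a y := by
  -- The equation Lu = v reads (pu')' = t²u - v, so u should be a primitive of this f up to a
  -- homogeneous solution.
  set f : ℝ → ℂ := fun t => ((t ^ 2 : ℝ) : ℂ) * u t - v t with hf_def
  have hf2 : MemLp f 2 (mu a) := (memLp_continuous_mul (by fun_prop) hu).sub hv
  have hf : Integrable f (mu a) := hf2.integrable one_le_two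
  have hul : LocallyIntegrableOn u (Ioo (-a) a) :=
    IntegrableOn.locallyIntegrableOn (hu.integrable one_le_two)
  have hcl : ∀ {g : ℝ → ℂ}, ContinuousOn g (Ioo (-a) a) → LocallyIntegrableOn g (Ioo (-a) a) :=
    fun hg => hg.locallyIntegrableOn measurableSet_Ioo
  have hy0 := classA_primitive hf 0 0
  have hz : LocallyIntegrableOn (fun t => u t - primitive a f 0 0 t) (Ioo (-a) a) :=
    hul.sub (hcl hy0.continuousOn)
  have hm := (classA_primitive (integrable_zero a) 1 0).continuousOn
  have h1l : LocallyIntegrableOn (fun _ : ℝ => (1 : ℂ)) (Ioo (-a) a) := hcl continuousOn_const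
  let F : Fin 2 → testSpace a →ₗ[ℂ] ℂ :=
    ![testFunctional ha (fun _ => 1) h1l, testFunctional ha (unitFlux a) (hcl hm)]
  -- A test function orthogonal to 1 and `unitFlux` equals (px')' with x compactly supported.
  -- Inserting x in the weak equation and in Green's formula shows that ψ annihilates u minus the
  -- particular solution.
  have hker : ⨅ i, LinearMap.ker (F i) ≤ LinearMap.ker (testFunctional ha _ hz) := by
    intro ψ hψ
    rw [Submodule.mem_iInf] at hψ
    have h1 : ∫ t, ψ.1 t * 1 ∂mu a = 0 := hψ 0
    have h2 : ∫ t, ψ.1 t * unitFlux a t ∂mu a = 0 := hψ 1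
    have hψc := (exists_radius ha ψ.2).1
    have hψ2 := memLp_of_continuous a hψc
    have hψi : Integrable ψ.1 (mu a) := hψ2.integrable one_le_two
    obtain ⟨c, d, r, hr, hra, hψv, hx⟩ := exists_compact_solution ha ψ.2 h1 h2
    have hA := classA_primitive hψi c d
    have hx2 : MemLp (primitive a ψ.1 c d) 2 (mu a) :=
      memLp_of_vanish hr hra hA.continuousOn fun t ht htr => (hx t ht htr).1
    have hL2 : MemLp (formalL a (primitive a ψ.1 c d)) 2 (mu a) :=
      (memLp_congr_ae (formalL_primitive hψi c d)).2
        (hψ2.neg.add (memLp_continuous_mul (by fun_prop) hx2))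
    have h3 := h _ ⟨hA, Icc (-r) r, isCompact_Icc, Icc_subset_of_lt hra, fun t ht htr =>
      (hx t ht fun h' => htr (Ioo_subset_Icc_self h')).1⟩ ⟨hA, hx2, hL2⟩
    have h4 : ∫ t, formalL a (primitive a ψ.1 c d) t * u t ∂mu a =
        ∫ t, ((primitive a ψ.1 c d t * f t + primitive a ψ.1 c d t * v t) - ψ.1 t * u t) ∂mu a := by
      refine integral_congr_ae ?_
      filter_upwards [formalL_primitive hψi c d] with t ht
      rw [ht, hf_def]
      ring
    have hxf : Integrable (fun t => primitive a ψ.1 c d t * f t) (mu a) := hx2.integrable_mul hf2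
    have hxv : Integrable (fun t => primitive a ψ.1 c d t * v t) (mu a) := hx2.integrable_mul hv
    have hxfv : Integrable
        (fun t => primitive a ψ.1 c d t * f t + primitive a ψ.1 c d t * v t) (mu a) := hxf.add hxv
    have hψu : Integrable (fun t => ψ.1 t * u t) (mu a) := hψ2.integrable_mul hu
    have hψy := integrable_test_mul ha ψ.2 (hcl hy0.continuousOn)
    rw [h4, integral_sub hxfv hψu, integral_add hxf hxv] at h3
    have h5 := green_primitive hr hra hψi hf c d 0 0
    have hrI : r ∈ Ioo (-a) a := ⟨by linarith, by linarith⟩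
    have hrI' : -r ∈ Ioo (-a) a := ⟨by linarith, by linarith⟩
    obtain ⟨e1, e2⟩ := hx r hrI fun h => h.2.ne rfl
    obtain ⟨e3, e4⟩ := hx (-r) hrI' fun h => h.1.ne rfl
    rw [wronskian, wronskian, e1, e2, e3, e4, ← integral_eq_of_vanish hr hra fun t ht htr => by
      rw [(hx t ht htr).1, hψv t htr]; ring, integral_sub hxf hψy] at h5
    change ∫ t, ψ.1 t * (u t - primitive a f 0 0 t) ∂mu a = 0
    simp only [mul_sub]
    rw [integral_sub hψu hψy]
    linear_combination h5 - h3
  -- A functional vanishing on the common kernel of finitely many functionals is a linear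
  -- combination of them. This determines the homogeneous part of u.
  obtain ⟨k, hk⟩ := (Submodule.mem_span_range_iff_exists_fun ℂ).1 (mem_span_of_iInf_ker_le_ker hker)
  have hlin : LocallyIntegrableOn (fun t => k 1 * unitFlux a t + k 0) (Ioo (-a) a) :=
    hcl ((continuousOn_const.mul hm).add continuousOn_const)
  have hzero : (fun t => u t - primitive a f 0 0 t - (k 1 * unitFlux a t + k 0)) =ᵐ[mu a] 0 := by
    refine ae_eq_zero_of_integral_smooth_mul (hz.sub hlin) fun φ h1 h2 h3 => ?_
    have hφ := ofReal_comp_mem_testSpace ha h1.continuous h2 h3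
    have h4 := LinearMap.congr_fun hk ⟨_, hφ⟩
    simp only [Fin.sum_univ_two, LinearMap.add_apply, LinearMap.smul_apply, smul_eq_mul, F,
      Matrix.cons_val_zero, Matrix.cons_val_one] at h4
    change k 0 * ∫ t, (φ t : ℂ) * 1 ∂mu a + k 1 * ∫ t, (φ t : ℂ) * unitFlux a t ∂mu a =
      ∫ t, (φ t : ℂ) * (u t - primitive a f 0 0 t) ∂mu a at h4
    have i1 := integrable_test_mul ha hφ h1l
    have i2 := integrable_test_mul ha hφ (hcl hm)
    have i3 := integrable_test_mul ha hφ hz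
    rw [← integral_const_mul, ← integral_const_mul,
      ← integral_add (i1.const_mul _) (i2.const_mul _)] at h4
    have i4 : Integrable (fun t => k 0 * ((φ t : ℂ) * 1) + k 1 * ((φ t : ℂ) * unitFlux a t))
        (mu a) := (i1.const_mul _).add (i2.const_mul _)
    refine Eq.trans ?_ (sub_eq_zero.2 h4.symm)
    rw [← integral_sub i3 i4]
    congr 1 with t
    ring
  have huy : u =ᵐ[mu a] primitive a f (k 1) (k 0) := by
    filter_upwards [hzero, ae_restrict_mem measurableSet_Ioo] with t ht htI
    rw [primitive_eq hf _ _ htI]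
    simp only [Pi.zero_apply] at ht
    linear_combination ht
  refine ⟨_, classA_primitive hf (k 1) (k 0), huy, ?_⟩
  filter_upwards [formalL_primitive hf (k 1) (k 0), huy] with t h1 h2
  rw [h1, ← h2, hf_def]
  ring

/-- A smooth function with compact support belongs to the core of the minimal operator. -/
theorem smooth_mem_core {a : ℝ} {φ : ℝ → ℝ} (h1 : ContDiff ℝ (⊤ : ℕ∞) φ)
    (h2 : HasCompactSupport φ) (h3 : tsupport φ ⊆ Ioo (-a) a) :
    ClassA₀ a (fun t => (φ t : ℂ)) ∧ InDomain a fun t => (φ t : ℂ) := by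
  have hd : ∀ t, HasDerivAt (fun t => (φ t : ℂ)) ((deriv φ t : ℝ) : ℂ) t := fun t =>
    (h1.differentiable (by simp) t).hasDerivAt.ofReal_comp
  have hd1 : ContDiff ℝ 1 (deriv φ) :=
    (contDiff_infty_iff_deriv.1 h1).2.of_le (by exact_mod_cast le_top)
  have hD : InDomain a fun t => (φ t : ℂ) := by
    refine inDomain_of_hasDerivAt (q := fun t => ((weight a t * deriv φ t : ℝ) : ℂ))
      (fun t ht => ?_) (Complex.ofRealCLM.contDiff.comp ((contDiff_weight a).mul hd1))
      (memLp_of_continuous a (Complex.continuous_ofReal.comp h1.continuous))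
    rw [Complex.ofReal_mul, mul_div_cancel_left₀ _ (weight_ne_zero ht)]
    exact hd t
  refine ⟨⟨hD.classA, tsupport φ, h2.isCompact, h3, fun t _ ht => ?_⟩, hD⟩
  rw [image_eq_zero_of_notMem_tsupport ht, Complex.ofReal_zero]

/-! ### Traces in ℂ² × ℂ² and the boundary form. -/

open Matrix

theorem mem_graph_domRestrict {a : ℝ} {T : H a →ₗ.[ℂ] H a} {S : Submodule ℂ (H a)} {u f : H a} :
    (u, f) ∈ (T.domRestrict S).graph ↔ u ∈ S ∧ (u, f) ∈ T.graph := by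
  constructor
  · intro h
    have hu := LinearPMap.mem_domain_of_mem_graph h
    exact ⟨hu.1, LinearPMap.le_graph_of_le LinearPMap.domRestrict_le h⟩
  · rintro ⟨hS, hg⟩
    have hd : u ∈ T.domain := LinearPMap.mem_domain_of_mem_graph hg
    rw [← LinearPMap.image_iff hd] at hg
    rw [← LinearPMap.image_iff (show u ∈ (T.domRestrict S).domain from ⟨hS, hd⟩), hg]
    exact (LinearPMap.domRestrict_apply rfl).symm

/-- `w` and `v` are the vectors `b + i c` and `b - i c` formed from the boundary values of the
function representing `u`. -/
def HasTrace (a : ℝ) (u : H a) (w v : Fin 2 → ℂ) : Prop :=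
  ∃ x : ℝ → ℂ, ClassA a x ∧ u =ᵐ[mu a] x ∧
    HasBoundaryValues a x ((w 0 + v 0) / 2) (-Complex.I * (w 0 - v 0) / 2)
      ((w 1 + v 1) / 2) (-Complex.I * (w 1 - v 1) / 2)

theorem hasTrace_of_boundaryValues {a : ℝ} {u : H a} {x : ℝ → ℂ} (hx : ClassA a x)
    (hu : u =ᵐ[mu a] x) {bm cm bp cp : ℂ} (h : HasBoundaryValues a x bm cm bp cp) :
    HasTrace a u ![bm + Complex.I * cm, bp + Complex.I * cp]
      ![bm - Complex.I * cm, bp - Complex.I * cp] := by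
  refine ⟨x, hx, hu, ?_⟩
  simp only [cons_val_zero, cons_val_one]
  convert h using 1
  · ring
  · linear_combination -cm * Complex.I_sq
  · ring
  · linear_combination -cp * Complex.I_sq

/-- Substituting b + ic = w and b - ic = v, the two conditions collect into v + Uw = 0. -/
theorem boundaryCondition_iff (U : Matrix (Fin 2) (Fin 2) ℂ) (w v : Fin 2 → ℂ) :
    BoundaryCondition U ((w 0 + v 0) / 2) (-Complex.I * (w 0 - v 0) / 2)
      ((w 1 + v 1) / 2) (-Complex.I * (w 1 - v 1) / 2) ↔ v = -(U *ᵥ w) := by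
  simp only [BoundaryCondition, funext_iff, Fin.forall_fin_two, Pi.neg_apply, mulVec, dotProduct,
    Fin.sum_univ_two]
  refine and_congr ⟨fun h => ?_, fun h => ?_⟩ ⟨fun h => ?_, fun h => ?_⟩
  · linear_combination h - ((1 - U 0 0) * (w 0 - v 0) / 2 - U 0 1 * (w 1 - v 1) / 2) * Complex.I_sq
  · linear_combination h + ((1 - U 0 0) * (w 0 - v 0) / 2 - U 0 1 * (w 1 - v 1) / 2) * Complex.I_sq
  · linear_combination h - ((1 - U 1 1) * (w 1 - v 1) / 2 - U 1 0 * (w 0 - v 0) / 2) * Complex.I_sq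
  · linear_combination h + ((1 - U 1 1) * (w 1 - v 1) / 2 - U 1 0 * (w 0 - v 0) / 2) * Complex.I_sq

/-- Representatives in 𝒜 of one L² class are continuous, hence agree on the whole interval, so the
trace depends only on the class. -/
theorem HasTrace.unique {a : ℝ} (ha : 0 < a) {u : H a} {w v w' v' : Fin 2 → ℂ}
    (h : HasTrace a u w v) (h' : HasTrace a u w' v') : w = w' ∧ v = v' := by
  obtain ⟨x, hx, hux, hb⟩ := h
  obtain ⟨y, hy, huy, hb'⟩ := h'
  obtain ⟨e1, e2, e3, e4⟩ := hb.unique ha (hx.eqOn_of_ae hy (hux.symm.trans huy)) hb'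
  have f1 : w 0 - v 0 = w' 0 - v' 0 := by
    linear_combination 2 * Complex.I * e2 + (w 0 - v 0 - (w' 0 - v' 0)) * Complex.I_sq
  have f2 : w 1 - v 1 = w' 1 - v' 1 := by
    linear_combination 2 * Complex.I * e4 + (w 1 - v 1 - (w' 1 - v' 1)) * Complex.I_sq
  constructor <;> ext i <;> fin_cases i
  · simp only [Fin.zero_eta]; linear_combination e1 + f1 / 2
  · simp only [Fin.mk_one]; linear_combination e3 + f2 / 2
  · simp only [Fin.zero_eta]; linear_combination e1 - f1 / 2
  · simp only [Fin.mk_one]; linear_combination e3 - f2 / 2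

theorem HasTrace.add {a : ℝ} {u u' : H a} {w v w' v' : Fin 2 → ℂ}
    (h : HasTrace a u w v) (h' : HasTrace a u' w' v') : HasTrace a (u + u') (w + w') (v + v') := by
  obtain ⟨x, hx, hux, hb⟩ := h
  obtain ⟨y, hy, huy, hb'⟩ := h'
  refine ⟨x + y, hx.add hy, (Lp.coeFn_add _ _).trans (hux.add huy), ?_⟩
  convert hb.add hx hy hb' using 1 <;> simp only [Pi.add_apply] <;> ring

theorem HasTrace.smul {a : ℝ} {u : H a} {w v : Fin 2 → ℂ} (c : ℂ) (h : HasTrace a u w v) :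
    HasTrace a (c • u) (c • w) (c • v) := by
  obtain ⟨x, hx, hux, hb⟩ := h
  refine ⟨c • x, hx.smul c, (Lp.coeFn_smul _ _).trans (hux.const_smul c), ?_⟩
  convert hb.smul c hx using 1 <;> simp only [Pi.smul_apply, smul_eq_mul] <;> ring

theorem inDomain_of_mem_maxGraph {a : ℝ} {u f : H a} {x : ℝ → ℂ} (hx : ClassA a x)
    (hu : u =ᵐ[mu a] x) (hf : f =ᵐ[mu a] formalL a x) : InDomain a x :=
  ⟨hx, (memLp_congr_ae hu).1 (Lp.memLp u), (memLp_congr_ae hf).1 (Lp.memLp f)⟩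

theorem exists_hasTrace {a : ℝ} (ha : 0 < a) {u f : H a} (h : (u, f) ∈ maxGraph a) :
    ∃ w v, HasTrace a u w v := by
  obtain ⟨x, hx, hu, hf⟩ := h
  obtain ⟨bm, cm, bp, cp, hb⟩ := (inDomain_of_mem_maxGraph hx hu hf).exists_boundaryValues ha
  exact ⟨_, _, hasTrace_of_boundaryValues hx hu hb⟩

theorem exists_mem_maxGraph_hasTrace {a : ℝ} (ha : 0 < a) (w v : Fin 2 → ℂ) :
    ∃ u f : H a, (u, f) ∈ maxGraph a ∧ HasTrace a u w v := by
  obtain ⟨x, hx, hb⟩ := exists_inDomain_hasBoundaryValues ha ((w 0 + v 0) / 2)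
    (-Complex.I * (w 0 - v 0) / 2) ((w 1 + v 1) / 2) (-Complex.I * (w 1 - v 1) / 2)
  exact ⟨hx.memLp.toLp x, hx.memLp_formalL.toLp _,
    ⟨x, hx.classA, hx.memLp.coeFn_toLp, hx.memLp_formalL.coeFn_toLp⟩,
    ⟨x, hx.classA, hx.memLp.coeFn_toLp, hb⟩⟩

theorem inner_eq_integral {a : ℝ} {u v : H a} {x y : ℝ → ℂ} (hu : u =ᵐ[mu a] x)
    (hv : v =ᵐ[mu a] y) : inner ℂ u v = ∫ t, star (x t) * y t ∂mu a := by
  rw [L2.inner_def]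
  refine integral_congr_ae ?_
  filter_upwards [hu, hv] with t h1 h2
  rw [h1, h2, RCLike.inner_apply, mul_comm]
  rfl

/-- Green's formula for the maximal operator. -/
theorem inner_sub_inner {a : ℝ} (ha : 0 < a) {u f u' f' : H a} {w v w' v' : Fin 2 → ℂ}
    (h : (u, f) ∈ maxGraph a) (h' : (u', f') ∈ maxGraph a) (ht : HasTrace a u w v)
    (ht' : HasTrace a u' w' v') :
    inner ℂ f' u - inner ℂ u' f = -(Complex.I / a) * (star v' ⬝ᵥ v - star w' ⬝ᵥ w) := by
  -- Graph membership and the trace may come with different representatives; they agree on the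
  -- interval, so one function serves both.
  have key : ∀ {u f : H a} {w v : Fin 2 → ℂ}, (u, f) ∈ maxGraph a → HasTrace a u w v →
      ∃ x, InDomain a x ∧ u =ᵐ[mu a] x ∧ f =ᵐ[mu a] formalL a x ∧
        HasBoundaryValues a x ((w 0 + v 0) / 2) (-Complex.I * (w 0 - v 0) / 2)
      ((w 1 + v 1) / 2) (-Complex.I * (w 1 - v 1) / 2) := by
    rintro u f w v ⟨y, hy, huy, hfy⟩ ⟨x, hx, hux, hb⟩
    have hfx : f =ᵐ[mu a] formalL a x := by
      filter_upwards [hfy, ae_restrict_mem measurableSet_Ioo] with t h1 ht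
      rw [h1, formalL_congr (hy.eqOn_of_ae hx (huy.symm.trans hux)) ht]
    exact ⟨x, inDomain_of_mem_maxGraph hx hux hfx, hux, hfx, hb⟩
  obtain ⟨x, hx, hux, hfx, hb⟩ := key h ht
  obtain ⟨y, hy, huy, hfy, hb'⟩ := key h' ht'
  have hg := hx.integral_green ha hy.star hb hb'.star
  simp only [formalL_star] at hg
  have i1 : Integrable (fun t => formalL a x t * star (y t)) (mu a) :=
    hx.memLp_formalL.integrable_mul hy.memLp.star
  have i2 : Integrable (fun t => x t * star (formalL a y t)) (mu a) :=
    hx.memLp.integrable_mul hy.memLp_formalL.star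
  rw [integral_sub i1 i2] at hg
  rw [inner_eq_integral hfy hux, inner_eq_integral huy hfx]
  simp only [mul_comm (formalL a x _), mul_comm (x _)] at hg
  simp only [dotProduct, Fin.sum_univ_two, Pi.star_apply]
  rw [← neg_sub, hg]
  simp only [star_div₀, star_mul', star_neg, star_sub, star_add, Complex.star_def, Complex.conj_I,
    Complex.conj_ofNat]
  ring

/-! ### The compactly supported core and its adjoint. -/

theorem hasBoundaryValues_of_classA₀ {a : ℝ} {x : ℝ → ℂ} (hx : ClassA₀ a x) :
    HasBoundaryValues a x 0 0 0 0 := by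
  obtain ⟨K, hK, hKI, h⟩ := hx.supp
  have h0 : ∀ t ∈ Ioo (-a) a ∩ Kᶜ, x t = 0 ∧ deriv x t = 0 := by
    intro t ht
    refine ⟨h t ht.1 ht.2, ?_⟩
    have he : x =ᶠ[𝓝 t] fun _ => 0 := by
      filter_upwards [(isOpen_Ioo.inter hK.isClosed.isOpen_compl).mem_nhds ht] with s hs
      exact h s hs.1 hs.2
    rw [he.deriv_eq, deriv_const]
  have hc : ∀ c ∉ Ioo (-a) a, ∀ᶠ t in 𝓝[Ioo (-a) a] c, x t = 0 ∧ deriv x t = 0 := by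
    intro c hc
    filter_upwards [self_mem_nhdsWithin, mem_nhdsWithin_of_mem_nhds
      (hK.isClosed.isOpen_compl.mem_nhds fun h' => hc (hKI h'))] with t h1 h2
    exact h0 t ⟨h1, h2⟩
  have hm := hc (-a) fun h => h.1.ne rfl
  have hp := hc a fun h => h.2.ne rfl
  constructor
  · exact tendsto_const_nhds.congr' (hm.mono fun t ht => by simp [ht.2])
  · exact tendsto_const_nhds.congr' (hm.mono fun t ht => by simp [ht.1, ht.2])
  · exact tendsto_const_nhds.congr' (hp.mono fun t ht => by simp [ht.2])
  · exact tendsto_const_nhds.congr' (hp.mono fun t ht => by simp [ht.1, ht.2])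

theorem mem_graph_Lcore {a : ℝ} {x : ℝ → ℂ} (hx : ClassA₀ a x) (hD : InDomain a x) :
    (hD.memLp.toLp x, hD.memLp_formalL.toLp _) ∈ (Lcore a).graph := by
  rw [Lcore, mem_graph_domRestrict, graph_Lmax]
  exact ⟨⟨x, hx, hD.memLp.coeFn_toLp⟩, x, hx.toClassA, hD.memLp.coeFn_toLp,
    hD.memLp_formalL.coeFn_toLp⟩

theorem ClassA₀.star {a : ℝ} {x : ℝ → ℂ} (hx : ClassA₀ a x) : ClassA₀ a fun t => star (x t) := by
  obtain ⟨hA, K, hK, hKI, h⟩ := hx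
  exact ⟨hA.star, K, hK, hKI, fun t ht htK => by simp [h t ht htK]⟩

/-- An element orthogonal to all smooth functions compactly supported in the interval is zero.
Density is needed to identify the graph of the adjoint operator with the adjoint of the graph. -/
theorem dense_Lcore_domain (a : ℝ) : Dense ((Lcore a).domain : Set (H a)) := by
  rw [Submodule.dense_iff_topologicalClosure_eq_top, Submodule.topologicalClosure_eq_top_iff,
    Submodule.eq_bot_iff]
  intro u hu
  have h0 : (u : ℝ → ℂ) =ᵐ[mu a] 0 := by
    refine ae_eq_zero_of_integral_smooth_mul (IntegrableOn.locallyIntegrableOn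
      ((Lp.memLp u).integrable one_le_two)) fun φ h1 h2 h3 => ?_
    obtain ⟨hx, hD⟩ := smooth_mem_core h1 h2 h3
    have h4 := (Submodule.mem_orthogonal _ _).1 hu _
      (LinearPMap.mem_domain_of_mem_graph (mem_graph_Lcore hx hD))
    rw [inner_eq_integral (MemLp.coeFn_toLp _) (EventuallyEq.refl _ _)] at h4
    simpa using h4
  exact Lp.ext (h0.trans (Lp.coeFn_zero _ _ _).symm)

theorem adjoint_graph_Lcore_le {a : ℝ} (ha : 0 < a) : (Lcore a).graph.adjoint ≤ maxGraph a := by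
  rintro ⟨u, f⟩ h
  rw [Submodule.mem_adjoint_iff] at h
  refine exists_classA_of_weak_solution ha (Lp.memLp u) (Lp.memLp f) fun x hx hD => ?_
  -- The weak equation is bilinear while the inner product conjugates its first argument, so the
  -- test function is conjugated.
  have h1 := h _ _ (mem_graph_Lcore hx.star hD.star)
  rw [inner_eq_integral (MemLp.coeFn_toLp _) (EventuallyEq.refl _ _),
    inner_eq_integral (MemLp.coeFn_toLp _) (EventuallyEq.refl _ _)] at h1
  simpa only [formalL_star, star_star, sub_eq_zero] using h1

theorem adjoint_graph_anti {a : ℝ} {S T : H a →ₗ.[ℂ] H a} (h : S ≤ T) :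
    T.graph.adjoint ≤ S.graph.adjoint := by
  intro p hp
  rw [Submodule.mem_adjoint_iff] at hp ⊢
  exact fun u f huf => hp u f (LinearPMap.le_graph_of_le h huf)

theorem mem_graph_LU {a : ℝ} {U : Matrix (Fin 2) (Fin 2) ℂ} {u f : H a} :
    (u, f) ∈ (LU a U).graph ↔
      (u, f) ∈ maxGraph a ∧ ∃ w v, HasTrace a u w v ∧ v = -(U *ᵥ w) := by
  rw [LU, mem_graph_domRestrict, graph_Lmax, and_comm]
  refine and_congr_right fun _ => ⟨?_, ?_⟩
  · rintro ⟨x, hx, hu, bm, cm, bp, cp, hb, hU⟩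
    refine ⟨_, _, hasTrace_of_boundaryValues hx hu hb, ?_⟩
    rw [← boundaryCondition_iff]
    simp only [cons_val_zero, cons_val_one]
    convert hU using 1
    · ring
    · linear_combination -cm * Complex.I_sq
    · ring
    · linear_combination -cp * Complex.I_sq
  · rintro ⟨w, v, ⟨x, hx, hu, hb⟩, hU⟩
    exact ⟨x, hx, hu, _, _, _, _, hb, (boundaryCondition_iff U w v).2 hU⟩

theorem Lcore_le_LU (a : ℝ) (U : Matrix (Fin 2) (Fin 2) ℂ) : Lcore a ≤ LU a U := by
  refine LinearPMap.le_of_le_graph ?_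
  rintro ⟨u, f⟩ h
  rw [Lcore, mem_graph_domRestrict, graph_Lmax] at h
  obtain ⟨⟨x, hx, hu⟩, hg⟩ := h
  refine mem_graph_LU.2 ⟨hg, 0, 0, ⟨x, hx.toClassA, hu, ?_⟩, by simp⟩
  simpa using hasBoundaryValues_of_classA₀ hx

theorem dense_of_Lcore_le {a : ℝ} {T : H a →ₗ.[ℂ] H a} (h : Lcore a ≤ T) :
    Dense (T.domain : Set (H a)) :=
  (dense_Lcore_domain a).mono h.1

theorem star_mulVec_dotProduct (U : Matrix (Fin 2) (Fin 2) ℂ) (w v : Fin 2 → ℂ) :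
    star (U *ᵥ w) ⬝ᵥ v = star w ⬝ᵥ (star U *ᵥ v) := by
  rw [star_mulVec, dotProduct_mulVec]
  rfl

theorem eq_of_star_dotProduct {p q : Fin 2 → ℂ} (h : ∀ w : Fin 2 → ℂ, star w ⬝ᵥ p = star w ⬝ᵥ q) :
    p = q :=
  dotProduct_eq _ _ fun w => by
    rw [dotProduct_comm p, dotProduct_comm q]
    simpa using h (star w)

theorem I_div_ne_zero {a : ℝ} (ha : 0 < a) : -(Complex.I / (a : ℂ)) ≠ 0 :=
  neg_ne_zero.2 (div_ne_zero Complex.I_ne_zero (Complex.ofReal_ne_zero.2 ha.ne'))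

/-! ### The operators L_U. -/

theorem isSelfAdjoint_LU {a : ℝ} (ha : 0 < a) {U : Matrix (Fin 2) (Fin 2) ℂ}
    (hU : U ∈ unitaryGroup (Fin 2) ℂ) : IsSelfAdjoint (LU a U) := by
  have hc := Lcore_le_LU a U
  have hU1 := mem_unitaryGroup_iff.1 hU
  have hU2 := mem_unitaryGroup_iff'.1 hU
  rw [LinearPMap.isSelfAdjoint_def]
  refine LinearPMap.eq_of_eq_graph ?_
  rw [LinearPMap.adjoint_graph_eq_graph_adjoint (dense_of_Lcore_le hc)]
  ext ⟨u, f⟩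
  constructor
  · intro h
    have hm := adjoint_graph_Lcore_le ha (adjoint_graph_anti hc h)
    rw [Submodule.mem_adjoint_iff] at h
    obtain ⟨w, v, ht⟩ := exists_hasTrace ha hm
    refine mem_graph_LU.2 ⟨hm, w, v, ht, ?_⟩
    -- Every trace (w', -Uw') occurs in L_U, so orthogonality to all of them forces w = -U*v, which
    -- U U* = 1 turns into v = -Uw.
    have h1 : w = -(star U *ᵥ v) := eq_of_star_dotProduct fun w' => by
      obtain ⟨u', f', hm', ht'⟩ := exists_mem_maxGraph_hasTrace ha w' (-(U *ᵥ w'))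
      have h2 := h u' f' (mem_graph_LU.2 ⟨hm', _, _, ht', rfl⟩)
      rw [inner_sub_inner ha hm hm' ht ht', mul_eq_zero, or_iff_right (I_div_ne_zero ha),
        sub_eq_zero, star_neg, neg_dotProduct, star_mulVec_dotProduct] at h2
      rw [dotProduct_neg, h2]
    rw [h1, mulVec_neg, neg_neg, mulVec_mulVec, hU1, one_mulVec]
  · intro h
    rw [Submodule.mem_adjoint_iff]
    obtain ⟨hm, w, v, ht, rfl⟩ := mem_graph_LU.1 h
    intro u' f' h'
    obtain ⟨hm', w', v', ht', rfl⟩ := mem_graph_LU.1 h'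
    rw [inner_sub_inner ha hm hm' ht ht', star_neg, neg_dotProduct, dotProduct_neg, neg_neg,
      star_mulVec_dotProduct, mulVec_mulVec, hU2, one_mulVec, sub_self, mul_zero]

/-- A self-adjoint operator is closed, so together with the core it contains the closure of the
core. -/
theorem Lmin_le_LU {a : ℝ} (ha : 0 < a) {U : Matrix (Fin 2) (Fin 2) ℂ}
    (hU : U ∈ unitaryGroup (Fin 2) ℂ) : Lmin a ≤ LU a U := by
  have hcl := (isSelfAdjoint_LU ha hU).isClosed
  have h := hcl.isClosable.closure_mono (Lcore_le_LU a U)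
  have he : (LU a U).closure = LU a U := by
    refine LinearPMap.eq_of_eq_graph ?_
    rw [← hcl.isClosable.graph_closure_eq_closure_graph]
    exact IsClosed.submodule_topologicalClosure_eq hcl
  rwa [he] at h

theorem trace_of_LU_le {a : ℝ} (ha : 0 < a) {U U' : Matrix (Fin 2) (Fin 2) ℂ}
    (h : LU a U ≤ LU a U') (w : Fin 2 → ℂ) : U *ᵥ w = U' *ᵥ w := by
  obtain ⟨u, f, hm, ht⟩ := exists_mem_maxGraph_hasTrace ha w (-(U *ᵥ w))
  obtain ⟨-, w', v', ht', hv'⟩ :=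
    mem_graph_LU.1 (LinearPMap.le_graph_of_le h (mem_graph_LU.2 ⟨hm, _, _, ht, rfl⟩))
  obtain ⟨rfl, rfl⟩ := ht.unique ha ht'
  exact neg_injective hv'

/-- A function with trace (w, -Uw) exists for every w, and its trace is unique, so both matrices act
alike on every vector. -/
theorem eq_of_LU_le {a : ℝ} (ha : 0 < a) {U U' : Matrix (Fin 2) (Fin 2) ℂ}
    (h : LU a U ≤ LU a U') : U = U' :=
  Matrix.ext_of_mulVec_single fun i => trace_of_LU_le ha h (Pi.single i 1)

/-- -U is unitary too. If L_U were minimal it would lie in the operator of -U, giving U = -U, so U =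
0, which is not unitary. -/
theorem Lmin_lt_LU {a : ℝ} (ha : 0 < a) {U : Matrix (Fin 2) (Fin 2) ℂ}
    (hU : U ∈ unitaryGroup (Fin 2) ℂ) : Lmin a < LU a U := by
  refine lt_of_le_of_ne (Lmin_le_LU ha hU) fun h => ?_
  have hU' : -U ∈ unitaryGroup (Fin 2) ℂ := by
    rw [mem_unitaryGroup_iff, star_neg, neg_mul_neg]
    exact mem_unitaryGroup_iff.1 hU
  have h1 : U = -U := eq_of_LU_le ha (h ▸ Lmin_le_LU ha hU')
  have h2 : U = 0 := Matrix.ext fun i j => self_eq_neg.1 (congrFun (congrFun h1 i) j)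
  have h3 := mem_unitaryGroup_iff.1 hU
  rw [h2, zero_mul] at h3
  exact zero_ne_one h3

theorem LU_lt_Lmax {a : ℝ} (ha : 0 < a) (U : Matrix (Fin 2) (Fin 2) ℂ) : LU a U < Lmax a := by
  refine lt_of_le_of_ne LinearPMap.domRestrict_le fun h => ?_
  -- A trace with w = 0 and v ≠ 0 violates v = -Uw for every U.
  obtain ⟨u, f, hm, ht⟩ := exists_mem_maxGraph_hasTrace ha 0 (fun _ => 1)
  have hm' := hm
  rw [← graph_Lmax, ← h] at hm'
  obtain ⟨-, w', v', ht', hv'⟩ := mem_graph_LU.1 hm'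
  obtain ⟨rfl, rfl⟩ := ht.unique ha ht'
  simpa using congrFun hv' 0

/-! ### Self-adjoint extensions as Lagrangian subspaces. -/

open scoped ComplexOrder in
/-- A Lagrangian subspace of `ℂ² × ℂ²` for the difference of the two inner products is the graph
of a unitary matrix. -/
theorem exists_unitary_of_lagrangian (V : Submodule ℂ ((Fin 2 → ℂ) × (Fin 2 → ℂ)))
    (hV : ∀ p, p ∈ V ↔ ∀ q ∈ V, star q.2 ⬝ᵥ p.2 = star q.1 ⬝ᵥ p.1) :
    ∃ A ∈ unitaryGroup (Fin 2) ℂ, ∀ p, p ∈ V ↔ p.2 = A *ᵥ p.1 := by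
  let π : V →ₗ[ℂ] (Fin 2 → ℂ) := (LinearMap.fst ℂ _ _).comp V.subtype
  -- On V the norms of w and v agree, so w = 0 forces v = 0.
  have hinj : Function.Injective π := by
    rw [← LinearMap.ker_eq_bot, LinearMap.ker_eq_bot']
    rintro ⟨⟨w, v⟩, hp⟩ (rfl : w = 0)
    have h1 := (hV _).1 hp _ hp
    have h2 : v = 0 := dotProduct_star_self_eq_zero.1 (h1.trans (dotProduct_zero _))
    subst h2
    rfl
  -- If the projection were not onto, some w₀ ≠ 0 would be orthogonal to its range. Then (w₀, 0) is
  -- orthogonal to V for the form, hence in V, and equality of norms gives w₀ = 0.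
  have hsurj : Function.Surjective π := by
    rw [← LinearMap.range_eq_top]
    by_contra hne
    obtain ⟨g, hg0, hg⟩ := Submodule.exists_le_ker_of_lt_top _ (lt_top_iff_ne_top.2 hne)
    let w₀ : Fin 2 → ℂ := fun i => star (g (Pi.single i 1))
    have hgw : ∀ w, g w = star w₀ ⬝ᵥ w := fun w => by
      conv_lhs => rw [pi_eq_sum_univ' w]
      simp [w₀, dotProduct, mul_comm]
    have hmem : (w₀, (0 : Fin 2 → ℂ)) ∈ V := (hV _).2 fun q hq => by
      have h1 : g q.1 = 0 := hg ⟨⟨q, hq⟩, rfl⟩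
      rw [hgw] at h1
      simp only [dotProduct_zero]
      rw [star_dotProduct, h1, star_zero]
    have h3 := (hV _).1 hmem _ hmem
    have h4 : w₀ = 0 := dotProduct_star_self_eq_zero.1 (h3.symm.trans (dotProduct_zero _))
    exact hg0 (LinearMap.ext fun w => by rw [hgw, h4]; simp)
  let e := LinearEquiv.ofBijective π ⟨hinj, hsurj⟩
  let L : (Fin 2 → ℂ) →ₗ[ℂ] (Fin 2 → ℂ) :=
    ((LinearMap.snd ℂ _ _).comp V.subtype).comp e.symm.toLinearMap
  have hL : ∀ w, (w, L w) ∈ V := fun w => by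
    have h1 : ((e.symm w : V) : (Fin 2 → ℂ) × (Fin 2 → ℂ)) = (w, L w) :=
      Prod.ext (e.apply_symm_apply w) rfl
    exact h1 ▸ (e.symm w).2
  have hA : ∀ w, LinearMap.toMatrix' L *ᵥ w = L w := fun w => LinearMap.toMatrix'_mulVec L w
  refine ⟨LinearMap.toMatrix' L, ?_, fun p => ?_⟩
  · rw [mem_unitaryGroup_iff']
    refine Matrix.ext_of_mulVec_single fun i => eq_of_star_dotProduct fun w => ?_
    rw [← mulVec_mulVec, ← star_mulVec_dotProduct, hA, hA, one_mulVec]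
    exact (hV _).1 (hL _) _ (hL w)
  · rw [hA]
    constructor
    · intro hp
      have h1 : (⟨p, hp⟩ : V) = ⟨_, hL p.1⟩ := hinj rfl
      exact congrArg (fun q : V => q.1.2) h1
    · intro hp
      have h1 := hL p.1
      rwa [← hp] at h1

theorem exists_eq_LU {a : ℝ} (ha : 0 < a) {T : H a →ₗ.[ℂ] H a} (hT : IsSelfAdjoint T)
    (hmin : Lmin a ≤ T) : ∃ U ∈ unitaryGroup (Fin 2) ℂ, T = LU a U := by
  have hc : Lcore a ≤ T := (LinearPMap.le_closure _).trans hmin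
  have hadj : T.graph.adjoint = T.graph := by
    rw [← LinearPMap.adjoint_graph_eq_graph_adjoint (dense_of_Lcore_le hc),
      LinearPMap.isSelfAdjoint_def.1 hT]
  have hmax : T.graph ≤ maxGraph a := by
    rw [← hadj]
    exact (adjoint_graph_anti hc).trans (adjoint_graph_Lcore_le ha)
  let V : Submodule ℂ ((Fin 2 → ℂ) × (Fin 2 → ℂ)) :=
    { carrier := {p | ∃ u f, (u, f) ∈ T.graph ∧ HasTrace a u p.1 p.2}
      zero_mem' := ⟨0, 0, T.graph.zero_mem, by
        simpa using! (hasTrace_of_boundaryValues (ClassA.zero a) (Lp.coeFn_zero _ _ _)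
          (HasBoundaryValues.zero a))⟩
      add_mem' := by
        rintro p q ⟨u, f, h1, h2⟩ ⟨u', f', h3, h4⟩
        exact ⟨_, _, T.graph.add_mem h1 h3, h2.add h4⟩
      smul_mem' := by
        rintro c p ⟨u, f, h1, h2⟩
        exact ⟨_, _, T.graph.smul_mem c h1, h2.smul c⟩ }
  -- Since T equals its adjoint, membership in T of a pair from the maximal graph depends only on
  -- its trace.
  have hiff : ∀ {u f w v}, (u, f) ∈ maxGraph a → HasTrace a u w v →
      ((u, f) ∈ T.graph ↔ ∀ q ∈ V, star q.2 ⬝ᵥ v = star q.1 ⬝ᵥ w) := by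
    intro u f w v hm ht
    rw [← hadj, Submodule.mem_adjoint_iff]
    constructor
    · rintro h q ⟨u', f', h1, h2⟩
      have h3 := h u' f' h1
      rwa [inner_sub_inner ha hm (hmax h1) ht h2, mul_eq_zero, or_iff_right (I_div_ne_zero ha),
        sub_eq_zero] at h3
    · intro h u' f' h1
      obtain ⟨w', v', h2⟩ := exists_hasTrace ha (hmax h1)
      rw [inner_sub_inner ha hm (hmax h1) ht h2, h (w', v') ⟨u', f', h1, h2⟩, sub_self, mul_zero]
  -- Every vector is the trace of some pair in the maximal graph, so the criterion on T descends to
  -- V.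
  have hV : ∀ p, p ∈ V ↔ ∀ q ∈ V, star q.2 ⬝ᵥ p.2 = star q.1 ⬝ᵥ p.1 := by
    intro p
    constructor
    · rintro ⟨u, f, h1, h2⟩
      exact (hiff (hmax h1) h2).1 h1
    · intro h
      obtain ⟨u, f, hm, ht⟩ := exists_mem_maxGraph_hasTrace ha p.1 p.2
      exact ⟨u, f, (hiff hm ht).2 h, ht⟩
  obtain ⟨A, hA, hVA⟩ := exists_unitary_of_lagrangian V hV
  -- The sign comes from the convention v = -Uw.
  refine ⟨-A, ?_, LinearPMap.eq_of_eq_graph ?_⟩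
  · rw [mem_unitaryGroup_iff, star_neg, neg_mul_neg]
    exact mem_unitaryGroup_iff.1 hA
  ext ⟨u, f⟩
  rw [mem_graph_LU]
  simp only [neg_mulVec, neg_neg]
  constructor
  · intro h
    obtain ⟨w, v, ht⟩ := exists_hasTrace ha (hmax h)
    exact ⟨hmax h, w, v, ht, (hVA (w, v)).1 ⟨u, f, h, ht⟩⟩
  · rintro ⟨hm, w, v, ht, hv⟩
    exact (hiff hm ht).2 ((hV (w, v)).1 ((hVA (w, v)).2 hv))

end Prolate

end

theorem theorem4p1 (a : ℝ) (ha : 0 < a) :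
    (∀ U ∈ Matrix.unitaryGroup (Fin 2) ℂ,
      IsSelfAdjoint (Prolate.LU a U) ∧
        Prolate.Lmin a < Prolate.LU a U ∧ Prolate.LU a U < Prolate.Lmax a) ∧
    (∀ T : Prolate.H a →ₗ.[ℂ] Prolate.H a, IsSelfAdjoint T → Prolate.Lmin a ≤ T →
      ∃ U ∈ Matrix.unitaryGroup (Fin 2) ℂ, T = Prolate.LU a U) ∧
    (∀ U₁ ∈ Matrix.unitaryGroup (Fin 2) ℂ, ∀ U₂ ∈ Matrix.unitaryGroup (Fin 2) ℂ,
      U₁ = U₂ ↔ Prolate.LU a U₁ = Prolate.LU a U₂) :=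
  ⟨fun U hU => ⟨Prolate.isSelfAdjoint_LU ha hU, Prolate.Lmin_lt_LU ha hU, Prolate.LU_lt_Lmax ha U⟩,
    fun _ hT hmin => Prolate.exists_eq_LU ha hT hmin,
    fun _ _ _ _ => ⟨fun h => h ▸ rfl, fun h => Prolate.eq_of_LU_le ha h.le⟩⟩
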